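/- **Setting.** There is a finite set of $n$ buyers, known in advance, and $m$ items arriving one at a time (item $j$ at time $j$; $m$ is not known in advance), with an edge set $E\subseteq\{1,\dots,n\}\times\{1,\dots,m\}$ saying which buyer is interested in which item. Buyer $i$ has a private value $v_i\ge 0$ for receiving at least one item she is interested in. Edges are public: when an item arrives, the buyers interested in it are revealed truthfully, and each of them bids her reported value $b_i\ge 0$, the same for all items she is interested in. An online algorithm then irrevocably assigns the item to an interested buyer who has no item yet, or to nobody, knowing only the interests and bids for the items that have arrived so far. A randomized algorithm is a random choice of a deterministic one. A tardy mechanism is an online algorithm together with nonnegative payments computed at the end of the process from all interests and bids. The utility of buyer $i$ is $v_i$ (if she gets an item she is interested in; otherwise $0$) minus her payment. A deterministic mechanism is truthful (for non-myopic buyers) if, for every $E$, every buyer $i$ and all reported values of the other buyers, reporting $v_i$ maximizes her utility; it is individually rational if reporting $v_i$ always gives nonnegative utility. A randomized mechanism is (ex-post) truthful, respectively individually rational, if every realization of it is. Let $\mathrm{OPT}(E,v)$ be the maximum weight of a matching in $E$, where the weight of an edge $(i,j)$ is $v_i$, and let $\mathrm{SW}$ be the sum of the values of the buyers who receive an item they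 are interested in. An algorithm is $\alpha$-competitive if $\mathrm{OPT}(E,v)\le\alpha\,\mathbb E[\mathrm{SW}]$ for all $E$ and $v$ (with truthful bids). For multipliers $y\in\mathbb R_{\ge0}^n$, the greedy rule with multipliers $y$ assigns every arriving item to the interested buyer without an item who maximizes $y_ib_i$ (ties in favour of the smallest index; nobody if there is no such buyer). *Greedy* is the case $y_i=1$. *Perturbed-Greedy* draws $x_1,\dots,x_n$ independently and uniformly from $[0,1]$ in advance and uses $y_i=1-e^{x_i-1}$. The critical-price payments for such a rule, with $y$ fixed, charge every buyer $i$ who receives an item the infimum of the values $z\ge 0$ such that $i$ would receive some item during the whole process when reporting $z$, everything else being unchanged; the other buyers pay $0$. **Theorem.** 1. Greedy with critical-price payments is a deterministic tardy mechanism that is truthful and individually rational, and it is $2$-competitive. 2. Perturbed-Greedy with the critical-price payments for the realized perturbations is a randomized tardy mechanism that is truthful and individually rational for every realization of the perturbations, and it is $\frac{e}{e-1}$-competitive in expectation. 3. Both ratios are tight, even for non-truthful algorithms. For every $\alpha<2$ there are $n,m$ and values $v$ such that for every deterministic online algorithm there is an edge set $E$ with $\alpha\cdot\mathrm{SW}<\mathrm{OPT}(E,v)$.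 For every $\alpha<\frac{e}{e-1}$ there are $n,m$ and values $v$ such that for every randomized online algorithm there is an edge set $E$ with $\alpha\cdot\mathbb E[\mathrm{SW}]<\mathrm{OPT}(E,v)$. -/

import Mathlib

open MeasureTheory
open scoped NNReal

noncomputable section

namespace OnlineMatching

/-- A bipartite graph with buyers `Fin n` and items `Fin m`; item `j` arrives at time `j`. -/
abbrev BuyerItemGraph (n m : ℕ) := Finset (Fin n × Fin m)

/-- What is observed when one item arrives: the set of the buyers who are interested in the item,
and their bids for it (the bid of a buyer who is not interested is `0`). -/
structure Report (n : ℕ) where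
  interested : Finset (Fin n)
  bid : Fin n → ℝ≥0

/-- The reports of the whole process (one per item, in order of arrival) when the edge set is `E`
and each buyer `i` reports the value `b i`. -/
def reports {n m : ℕ} (E : BuyerItemGraph n m) (b : Fin n → ℝ≥0) : List (Report n) :=
  List.ofFn fun j : Fin m =>
    { interested := Finset.univ.filter fun i => (i, j) ∈ E
      bid := fun i => if (i, j) ∈ E then b i else 0 }

/-- A deterministic online rule decides to whom the current item is assigned (`none`: to nobody),
knowing only the reports for the items that have arrived, the current item being the last one. -/
abbrev OnlineRule (n : ℕ) := List (Report n) → Option (Fin n)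

/-- The buyer to whom the item number `j` of the report sequence `h` is assigned. -/
def assign {n : ℕ} (A : OnlineRule n) (h : List (Report n)) (j : ℕ) : Option (Fin n) :=
  A (h.take (j + 1))

/-- Buyer `i` is assigned some item when the report sequence is `h`. -/
def Wins {n : ℕ} (A : OnlineRule n) (h : List (Report n)) (i : Fin n) : Prop :=
  ∃ j < h.length, assign A h j = some i

/-- The rule always outputs a matching of the graph: an item is assigned only to a buyer who is
interested in it, and no buyer is assigned two items. -/
def IsMatchingRule {n : ℕ} (A : OnlineRule n) : Prop :=
  ∀ (m : ℕ) (E : BuyerItemGraph n m) (b : Fin n → ℝ≥0),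
    (∀ (j : Fin m) (i : Fin n), assign A (reports E b) j = some i → (i, j) ∈ E) ∧
    (∀ (j k : Fin m) (i : Fin n), assign A (reports E b) j = some i →
      assign A (reports E b) k = some i → j = k)

/-- Buyer `i` receives an item she is interested in when the reported values are `b`. -/
def GetsDesired {n m : ℕ} (A : OnlineRule n) (E : BuyerItemGraph n m) (b : Fin n → ℝ≥0)
    (i : Fin n) : Prop :=
  ∃ j : Fin m, assign A (reports E b) j = some i ∧ (i, j) ∈ E

open Classical in
/-- Social welfare of the allocation when the reports are the true values `v`. -/
def welfare {n m : ℕ} (A : OnlineRule n) (E : BuyerItemGraph n m) (v : Fin n → ℝ≥0) : ℝ≥0 :=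
  ∑ i, if GetsDesired A E v i then v i else 0

/-- No two edges of `M` share a buyer or an item. -/
def IsMatching {n m : ℕ} (M : BuyerItemGraph n m) : Prop :=
  ∀ e ∈ M, ∀ f ∈ M, e.1 = f.1 ∨ e.2 = f.2 → e = f

open Classical in
/-- The maximum weight of a matching of `E`, the weight of an edge being its buyer's value. -/
def opt {n m : ℕ} (E : BuyerItemGraph n m) (v : Fin n → ℝ≥0) : ℝ≥0 :=
  (E.powerset.filter IsMatching).sup fun M => ∑ e ∈ M, v e.1

/-- `α`-competitiveness of a deterministic rule against the best offline matching. -/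
def IsCompetitive {n : ℕ} (α : ℝ) (A : OnlineRule n) : Prop :=
  ∀ (m : ℕ) (E : BuyerItemGraph n m) (v : Fin n → ℝ≥0), (opt E v : ℝ) ≤ α * welfare A E v

/-- A randomized online matching rule: a random choice of a deterministic one, with a random seed
in the measurable space `Ω` and measurable decisions. -/
def IsRandomizedMatchingRule {n : ℕ} {Ω : Type*} [MeasurableSpace Ω] (A : Ω → OnlineRule n) :
    Prop :=
  (∀ ω, IsMatchingRule (A ω)) ∧ ∀ h x, MeasurableSet {ω | A ω h = x}

/-- Expected social welfare of a randomized rule. -/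
def expectedWelfare {n m : ℕ} {Ω : Type*} [MeasurableSpace Ω] (P : Measure Ω)
    (A : Ω → OnlineRule n) (E : BuyerItemGraph n m) (v : Fin n → ℝ≥0) : ℝ :=
  ∫ ω, (welfare (A ω) E v : ℝ) ∂P

/-- `α`-competitiveness of a randomized rule, in expectation. -/
def IsCompetitiveInExpectation {n : ℕ} {Ω : Type*} [MeasurableSpace Ω] (α : ℝ) (P : Measure Ω)
    (A : Ω → OnlineRule n) : Prop :=
  ∀ (m : ℕ) (E : BuyerItemGraph n m) (v : Fin n → ℝ≥0),
    (opt E v : ℝ) ≤ α * expectedWelfare P A E v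

/-- A tardy mechanism: an online allocation rule, and nonnegative payments computed at the end of
the process from all reports. -/
structure TardyMechanism (n : ℕ) where
  alloc : OnlineRule n
  pay : List (Report n) → Fin n → ℝ≥0

open Classical in
/-- Quasi-linear utility of buyer `i` with true value `vi` when the reported values are `b`. -/
def TardyMechanism.utility {n m : ℕ} (M : TardyMechanism n) (E : BuyerItemGraph n m) (i : Fin n)
    (vi : ℝ≥0) (b : Fin n → ℝ≥0) : ℝ :=
  (if GetsDesired M.alloc E b i then (vi : ℝ) else 0) - M.pay (reports E b) i

/-- Truthfulness for non-myopic buyers with public edges: whatever the graph and the other reported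
values are, reporting the true value `vi` is at least as good as reporting any value `b i`. -/
def TardyMechanism.IsTruthful {n : ℕ} (M : TardyMechanism n) : Prop :=
  ∀ (m : ℕ) (E : BuyerItemGraph n m) (i : Fin n) (vi : ℝ≥0) (b : Fin n → ℝ≥0),
    M.utility E i vi b ≤ M.utility E i vi (Function.update b i vi)

/-- Individual rationality: a buyer who reports her true value has nonnegative utility. -/
def TardyMechanism.IsIndividuallyRational {n : ℕ} (M : TardyMechanism n) : Prop :=
  ∀ (m : ℕ) (E : BuyerItemGraph n m) (i : Fin n) (vi : ℝ≥0) (b : Fin n → ℝ≥0),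
    0 ≤ M.utility E i vi (Function.update b i vi)

/-- The report sequence `h` with every value reported by buyer `i` replaced by `z`. -/
def rebid {n : ℕ} (i : Fin n) (z : ℝ≥0) (h : List (Report n)) : List (Report n) :=
  h.map fun r =>
    { interested := r.interested
      bid := fun k => if k = i ∧ i ∈ r.interested then z else r.bid k }

/-- The critical price of buyer `i`: the infimum of the reports with which she is assigned an item,
the other reports and the interests being as in `h`. -/
def criticalPrice {n : ℕ} (A : OnlineRule n) (h : List (Report n)) (i : Fin n) : ℝ≥0 :=
  sInf {z : ℝ≥0 | Wins A (rebid i z h) i}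

open Classical in
/-- The tardy mechanism with allocation rule `A` in which every buyer who is assigned an item pays
her critical price, and every other buyer pays nothing. -/
def criticalPriceMechanism {n : ℕ} (A : OnlineRule n) : TardyMechanism n where
  alloc := A
  pay h i := if Wins A h i then criticalPrice A h i else 0

open Classical in
/-- The element of `S` with the largest score (the smallest one in case of a tie), if there is
one. -/
def argmax {n : ℕ} (S : Finset (Fin n)) (score : Fin n → ℝ) : Option (Fin n) :=
  if h : (S.filter fun i => ∀ k ∈ S, score k ≤ score i).Nonempty then
    some (Finset.min' _ h) else none

/-- One step of the weighted greedy rule. The state consists of the set of buyers who already have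
an item, and of the last decision. The new item goes to the interested buyer `i` without an item
for whom `y i * b i` is largest. -/
def greedyStep {n : ℕ} (y : Fin n → ℝ) (s : Finset (Fin n) × Option (Fin n)) (r : Report n) :
    Finset (Fin n) × Option (Fin n) :=
  let c := argmax (r.interested \ s.1) fun i => y i * r.bid i
  (s.1 ∪ c.toFinset, c)

/-- The greedy rule for reported values scaled by the multipliers `y`. -/
def weightedGreedy {n : ℕ} (y : Fin n → ℝ) : OnlineRule n :=
  fun h => (h.foldl (greedyStep y) (∅, none)).2

/-- Greedy: every item goes to the available interested buyer with the highest reported value. -/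
def greedy (n : ℕ) : OnlineRule n := weightedGreedy fun _ => 1

/-- Perturbed-Greedy for the perturbations `x`: greedy with multipliers `1 - exp (x i - 1)`. -/
def perturbedGreedy (n : ℕ) (x : Fin n → unitInterval) : OnlineRule n :=
  weightedGreedy fun i => 1 - Real.exp ((x i : ℝ) - 1)

end OnlineMatching

end

/-! Truthfulness. With nonnegative multipliers, raising a bid never loses an item
(`wins_rebid_mono`), and the critical price does not depend on the buyer's own bid. Each buyer thus
faces a fixed take-it-or-leave-it price.

Upper bounds. By weak LP duality (`mul_opt_le_of_edge_bound`) it suffices to give buyers and items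
nonnegative duals, of total controlled by the welfare, that cover every edge. For Greedy, both ends
of an assigned edge receive its full value, whence the factor 2. For Perturbed-Greedy the value `v
i` is split into `(1 - y i) * v i` for the buyer and `y i * v i` for the item. Fix an edge `(i, j)`
and all perturbations except `x i`, and let `s` be the score at which `j` is assigned when `i` is
absent. The presence of `i` never pushes the dual of `j` below `s`, and `i` is served whenever her
score exceeds `s` (`exists_score_le_dual`). The function `1 - exp (x - 1)` is such that averaging
over `x i` then yields at least `(1 - 1/e) * v i` for every `s` (`mul_le_integral_dual`).

Lower bounds. Deterministic: two buyers want the first item, and the second item is wanted only by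
the buyer who was just served. Randomized: in the upper triangular graph with randomly ordered
buyers, the positions still active at time `j` are indistinguishable, so each is served equally
often. This gives a small linear program for the number of served buyers (`sub_mul_assignCount_le`,
`sum_assignCount_le`), bounded by a Lagrange multiplier `D` close to `n / e`; averaging over orders
selects a bad one for any random mixture of rules. -/

namespace OnlineMatching

variable {n m : ℕ}

/-! ### The tie-breaking argmax. -/

section Argmax

variable {S T : Finset (Fin n)} {f g : Fin n → ℝ} {i : Fin n}

theorem argmax_eq_some_iff :
    argmax S f = some i ↔ i ∈ S ∧ ∀ k ∈ S, f k < f i ∨ (f k = f i ∧ i ≤ k) := by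
  unfold argmax
  split_ifs with h
  · have hmem := Finset.min'_mem _ h
    rw [Option.some_inj]
    constructor
    · rintro rfl
      rw [Finset.mem_filter] at hmem
      refine ⟨hmem.1, fun k hk => ?_⟩
      rcases (hmem.2 k hk).lt_or_eq with hlt | heq
      · exact Or.inl hlt
      · refine Or.inr ⟨heq, Finset.min'_le _ _ ?_⟩
        exact Finset.mem_filter.2 ⟨hk, fun l hl => heq ▸ hmem.2 l hl⟩
    · rintro ⟨hi, hmax⟩
      have hi' : i ∈ S.filter fun i => ∀ k ∈ S, f k ≤ f i :=
        Finset.mem_filter.2 ⟨hi, fun k hk => (hmax k hk).elim le_of_lt fun h => h.1.le⟩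
      refine le_antisymm (Finset.min'_le _ _ hi') ?_
      rw [Finset.mem_filter] at hmem
      exact (hmax _ hmem.1).elim (fun hlt => absurd (hmem.2 i hi) (not_le.2 hlt)) fun h => h.2
  · refine iff_of_false (by simp) ?_
    rintro ⟨hi, hmax⟩
    exact h ⟨i, Finset.mem_filter.2 ⟨hi, fun k hk => (hmax k hk).elim le_of_lt fun h => h.1.le⟩⟩

theorem argmax_eq_none_iff : argmax S f = none ↔ S = ∅ := by
  unfold argmax
  split_ifs with h
  · refine iff_of_false (by simp) ?_
    rintro rfl
    simp at h
  · refine iff_of_true rfl ?_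
    by_contra hS
    obtain ⟨i, hi, hmax⟩ := S.exists_max_image f (Finset.nonempty_iff_ne_empty.2 hS)
    exact h ⟨i, Finset.mem_filter.2 ⟨hi, hmax⟩⟩

theorem argmax_congr (h : ∀ k ∈ S, f k = g k) : argmax S f = argmax S g := by
  ext i
  rw [argmax_eq_some_iff, argmax_eq_some_iff]
  refine and_congr_right fun hi => forall₂_congr fun k hk => ?_
  rw [h k hk, h i hi]

/-- Ties are broken by index, so the winner stays the winner when competitors drop out. The
comparisons of runs with and without a buyer rest on this. -/
theorem argmax_of_subset (hST : S ⊆ T) (h : argmax T f = some i) (hi : i ∈ S) :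
    argmax S f = some i := by
  rw [argmax_eq_some_iff] at h ⊢
  exact ⟨hi, fun k hk => h.2 k (hST hk)⟩

theorem le_of_argmax_eq_some (h : argmax S f = some i) {k : Fin n} (hk : k ∈ S) : f k ≤ f i :=
  ((argmax_eq_some_iff.1 h).2 k hk).elim le_of_lt fun h => h.1.le

end Argmax

/-! ### Runs of the weighted greedy rule, extended one item at a time. -/

section Wins

theorem wins_append_singleton (A : OnlineRule n) (h : List (Report n)) (r : Report n) (i : Fin n) :
    Wins A (h ++ [r]) i ↔ Wins A h i ∨ A (h ++ [r]) = some i := by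
  unfold Wins assign
  constructor
  · rintro ⟨j, hj, hA⟩
    rw [List.length_append, List.length_singleton] at hj
    rcases Nat.lt_succ_iff_lt_or_eq.1 hj with hlt | rfl
    · rw [List.take_append_of_le_length (by omega)] at hA
      exact Or.inl ⟨j, hlt, hA⟩
    · rw [List.take_of_length_le (by simp)] at hA
      exact Or.inr hA
  · rintro (⟨j, hj, hA⟩ | hA)
    · refine ⟨j, by simp; omega, ?_⟩
      rwa [List.take_append_of_le_length (by omega)]
    · refine ⟨h.length, by simp, ?_⟩
      rwa [List.take_of_length_le (by simp)]

/-- The set of the buyers who have an item after the weighted greedy rule has processed `h`. -/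
noncomputable def matched (y : Fin n → ℝ) (h : List (Report n)) : Finset (Fin n) :=
  (h.foldl (greedyStep y) (∅, none)).1

variable (y : Fin n → ℝ) (h : List (Report n)) (r : Report n)

theorem weightedGreedy_append_singleton :
    weightedGreedy y (h ++ [r]) = argmax (r.interested \ matched y h) fun i => y i * r.bid i := by
  simp [weightedGreedy, matched, greedyStep]

theorem matched_append_singleton :
    matched y (h ++ [r]) = matched y h ∪ (weightedGreedy y (h ++ [r])).toFinset := by
  simp [weightedGreedy, matched, greedyStep]

theorem mem_matched_append_singleton {i : Fin n} :
    i ∈ matched y (h ++ [r]) ↔ i ∈ matched y h ∨ weightedGreedy y (h ++ [r]) = some i := by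
  simp [matched_append_singleton]

theorem mem_matched_iff_wins (i : Fin n) : i ∈ matched y h ↔ Wins (weightedGreedy y) h i := by
  induction h using List.reverseRecOn with
  | nil => simp [matched, Wins]
  | append_singleton h r ih => rw [mem_matched_append_singleton, wins_append_singleton, ih]

theorem mem_interested_of_weightedGreedy_eq_some {i : Fin n}
    (hi : weightedGreedy y (h ++ [r]) = some i) : i ∈ r.interested ∧ i ∉ matched y h := by
  rw [weightedGreedy_append_singleton, argmax_eq_some_iff, Finset.mem_sdiff] at hi
  exact hi.1

end Wins

/-! ### Report sequences that come from a graph. -/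

section Graph

variable (E : BuyerItemGraph n m) (b : Fin n → ℝ≥0)

/-- The report for the item `j`. -/
def itemReport (j : Fin m) : Report n where
  interested := Finset.univ.filter fun i => (i, j) ∈ E
  bid := fun i => if (i, j) ∈ E then b i else 0

theorem length_reports : (reports E b).length = m := by simp [reports]

theorem take_succ_reports (j : Fin m) :
    (reports E b).take (j + 1) = (reports E b).take j ++ [itemReport E b j] := by
  rw [List.take_succ_eq_append_getElem (by simp [length_reports])]
  simp [reports, itemReport]

variable {E b}

theorem mem_interested_itemReport {j : Fin m} {i : Fin n} :
    i ∈ (itemReport E b j).interested ↔ (i, j) ∈ E := by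
  simp [itemReport]

theorem bid_itemReport {j : Fin m} {i : Fin n} (hij : (i, j) ∈ E) :
    (itemReport E b j).bid i = b i := by
  simp [itemReport, hij]

theorem wins_reports_iff {A : OnlineRule n} {i : Fin n} :
    Wins A (reports E b) i ↔ ∃ j : Fin m, assign A (reports E b) j = some i := by
  unfold Wins
  rw [length_reports]
  exact ⟨fun ⟨j, hj, h⟩ => ⟨⟨j, hj⟩, h⟩, fun ⟨j, h⟩ => ⟨j, j.2, h⟩⟩

theorem IsMatchingRule.getsDesired_iff {A : OnlineRule n} (hA : IsMatchingRule A) {i : Fin n} :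
    GetsDesired A E b i ↔ ∃ j : Fin m, assign A (reports E b) j = some i :=
  exists_congr fun j => and_iff_left_of_imp ((hA m E b).1 j i)

theorem IsMatchingRule.getsDesired_iff_wins {A : OnlineRule n} (hA : IsMatchingRule A)
    {i : Fin n} : GetsDesired A E b i ↔ Wins A (reports E b) i := by
  rw [hA.getsDesired_iff, wins_reports_iff]

theorem assign_weightedGreedy (y : Fin n → ℝ) (j : Fin m) :
    assign (weightedGreedy y) (reports E b) j =
      weightedGreedy y ((reports E b).take j ++ [itemReport E b j]) := by
  rw [assign, take_succ_reports]

theorem matched_take_mono (y : Fin n → ℝ) (h : List (Report n)) {j k : ℕ} (hjk : j ≤ k) :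
    matched y (h.take j) ⊆ matched y (h.take k) := by
  induction k, hjk using Nat.le_induction with
  | base => exact subset_rfl
  | succ k _ ih =>
    refine ih.trans ?_
    rcases lt_or_ge k h.length with hk | hk
    · rw [List.take_succ_eq_append_getElem hk, matched_append_singleton]
      exact Finset.subset_union_left
    · rw [List.take_of_length_le hk, List.take_of_length_le (by omega)]

theorem isMatchingRule_weightedGreedy (y : Fin n → ℝ) : IsMatchingRule (weightedGreedy y) := by
  intro m E b
  refine ⟨fun j i hi => ?_, ?_⟩
  · rw [assign_weightedGreedy] at hi
    exact mem_interested_itemReport.1 (mem_interested_of_weightedGreedy_eq_some _ _ _ hi).1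
  · have key : ∀ (j k : Fin m) (i : Fin n), assign (weightedGreedy y) (reports E b) j = some i →
        assign (weightedGreedy y) (reports E b) k = some i → ¬ j < k := by
      intro j k i hj hk hjk
      rw [assign_weightedGreedy] at hj hk
      refine (mem_interested_of_weightedGreedy_eq_some _ _ _ hk).2
        (matched_take_mono y _ (Nat.succ_le_of_lt hjk) ?_)
      rw [Nat.succ_eq_add_one, take_succ_reports, mem_matched_append_singleton]
      exact Or.inr hj
    intro j k i hj hk
    exact le_antisymm (not_lt.1 (key k j i hk hj)) (not_lt.1 (key j k i hj hk))

theorem rebid_reports (i : Fin n) (z : ℝ≥0) :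
    rebid i z (reports E b) = reports E (Function.update b i z) := by
  unfold rebid reports
  rw [List.map_ofFn]
  congr 1
  funext j
  simp only [Function.comp, Finset.mem_filter, Finset.mem_univ, true_and, Report.mk.injEq]
  funext k
  by_cases hk : k = i
  · subst hk
    by_cases h : (k, j) ∈ E <;> simp [h]
  · simp [hk]

end Graph

/-! ### Monotonicity, and truthfulness of critical prices. -/

section Truthful

/-- Raising the own report never hurts the chances of getting an item. -/
theorem matched_rebid_mono {y : Fin n → ℝ} (hy : ∀ i, 0 ≤ y i) (i : Fin n) {z z' : ℝ≥0}
    (hz : z ≤ z') (h : List (Report n)) :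
    i ∈ matched y (rebid i z' h) ∨
      (i ∉ matched y (rebid i z h) ∧ matched y (rebid i z h) = matched y (rebid i z' h)) := by
  -- Mere monotonicity would not pass through the induction: as long as `i` is unserved with `z'`,
  -- the full states of the two runs must coincide.
  induction h using List.reverseRecOn with
  | nil => simp [rebid, matched]
  | append_singleton h r ih =>
    have hap : ∀ w, rebid i w (h ++ [r]) = rebid i w h ++ [⟨r.interested,
        fun k => if k = i ∧ i ∈ r.interested then w else r.bid k⟩] := fun w => by simp [rebid]
    rw [hap, hap, mem_matched_append_singleton, mem_matched_append_singleton]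
    rcases ih with ih | ⟨hi, heq⟩
    · exact Or.inl (Or.inl ih)
    · by_cases hw : weightedGreedy y (rebid i z' h ++ [⟨r.interested,
        fun k => if k = i ∧ i ∈ r.interested then z' else r.bid k⟩]) = some i
      · exact Or.inl (Or.inr hw)
      · right
        -- When `i` loses this item with `z'`, its winner also beats her lower score, ties included,
        -- so lowering her bid leaves the decision unchanged.
        have hwin : weightedGreedy y (rebid i z h ++ [⟨r.interested,
            fun k => if k = i ∧ i ∈ r.interested then z else r.bid k⟩]) =
            weightedGreedy y (rebid i z' h ++ [⟨r.interested,
            fun k => if k = i ∧ i ∈ r.interested then z' else r.bid k⟩]) := by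
          rw [weightedGreedy_append_singleton] at hw ⊢
          rw [weightedGreedy_append_singleton, heq]
          dsimp only at hw ⊢
          set S := r.interested \ matched y (rebid i z' h) with hS
          have hle : y i * (z : ℝ) ≤ y i * z' :=
            mul_le_mul_of_nonneg_left (NNReal.coe_le_coe.2 hz) (hy i)
          symm
          cases hc : argmax S fun k => y k *
              ((if k = i ∧ i ∈ r.interested then z' else r.bid k : ℝ≥0) : ℝ) with
          | none => rw [argmax_eq_none_iff] at hc; exact (argmax_eq_none_iff.2 hc).symm
          | some c =>
            have hci : c ≠ i := by rintro rfl; exact hw hc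
            symm
            rw [argmax_eq_some_iff] at hc ⊢
            refine ⟨hc.1, fun k hk => ?_⟩
            have := hc.2 k hk
            simp only [hci, false_and, if_false] at this ⊢
            by_cases hki : k = i
            · subst hki
              have hk' : k ∈ r.interested := (Finset.mem_sdiff.1 hk).1
              simp only [hk', and_self, if_true] at this ⊢
              rcases this with h1 | ⟨h1, h2⟩
              · exact Or.inl (hle.trans_lt h1)
              · rcases (hle.trans h1.le).lt_or_eq with h3 | h3
                · exact Or.inl h3
                · exact Or.inr ⟨h3, h2⟩
            · simpa only [hki, false_and, if_false] using this
        refine ⟨?_, by rw [matched_append_singleton, matched_append_singleton, hwin, heq]⟩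
        rw [hwin]
        exact not_or.2 ⟨hi, hw⟩

theorem wins_rebid_mono {y : Fin n → ℝ} (hy : ∀ i, 0 ≤ y i) {i : Fin n} {z z' : ℝ≥0}
    (hz : z ≤ z') {h : List (Report n)} (hw : Wins (weightedGreedy y) (rebid i z h) i) :
    Wins (weightedGreedy y) (rebid i z' h) i := by
  rw [← mem_matched_iff_wins] at hw ⊢
  exact (matched_rebid_mono hy i hz h).resolve_right fun h => h.1 hw

-- The critical price ignores the buyer's own report, so `z` decides only whether she wins, not at
-- what price.
open Classical in
theorem utility_criticalPriceMechanism {A : OnlineRule n} (hA : IsMatchingRule A)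
    (E : BuyerItemGraph n m) (i : Fin n) (vi z : ℝ≥0) (b : Fin n → ℝ≥0) :
    (criticalPriceMechanism A).utility E i vi (Function.update b i z) =
      if Wins A (rebid i z (reports E b)) i then
        (vi : ℝ) - criticalPrice A (reports E b) i else 0 := by
  have hprice : criticalPrice A (reports E (Function.update b i z)) i =
      criticalPrice A (reports E b) i := by
    simp [criticalPrice, rebid_reports]
  unfold TardyMechanism.utility criticalPriceMechanism
  simp only [hA.getsDesired_iff_wins, rebid_reports, hprice]
  split_ifs <;> simp

theorem isIndividuallyRational_criticalPriceMechanism {A : OnlineRule n} (hA : IsMatchingRule A) :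
    (criticalPriceMechanism A).IsIndividuallyRational := by
  intro m E i vi b
  rw [utility_criticalPriceMechanism hA]
  split_ifs with h
  · exact sub_nonneg.2 (NNReal.coe_le_coe.2 (csInf_le (OrderBot.bddBelow _) h))
  · exact le_rfl

theorem isTruthful_criticalPriceMechanism {A : OnlineRule n} (hA : IsMatchingRule A)
    (hmono : ∀ (i : Fin n) (z z' : ℝ≥0) (h : List (Report n)), z ≤ z' →
      Wins A (rebid i z h) i → Wins A (rebid i z' h) i) :
    (criticalPriceMechanism A).IsTruthful := by
  intro m E i vi b
  have hIR := isIndividuallyRational_criticalPriceMechanism hA m E i vi b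
  -- Writing `b` as its own update at `i` puts both utilities into the form of
  -- `utility_criticalPriceMechanism`.
  rw [← Function.update_eq_self i b, Function.update_idem, utility_criticalPriceMechanism hA]
  rw [← Function.update_eq_self i b, Function.update_idem] at hIR
  split_ifs with h
  · rcases le_or_gt vi (criticalPrice A (reports E b) i) with hle | hlt
    · exact (sub_nonpos.2 (NNReal.coe_le_coe.2 hle)).trans hIR
    -- The infimum need not be attained; some winning report strictly below `vi` is enough, since by
    -- monotonicity `vi` then wins at the same price.
    · obtain ⟨z, hz, hzlt⟩ := exists_lt_of_csInf_lt ⟨b i, h⟩ hlt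
      rw [utility_criticalPriceMechanism hA, if_pos (hmono i z vi _ hzlt.le hz)]
  · exact hIR

end Truthful

/-! ### Comparing the run with buyer `i` to the run without her. -/

section Withdraw

/-- The report sequence `h` when buyer `i` is not interested in any item. -/
def withdraw (i : Fin n) (h : List (Report n)) : List (Report n) :=
  h.map fun r => ⟨r.interested.erase i, r.bid⟩

variable {y y' : Fin n → ℝ} {i : Fin n}

theorem withdraw_append_singleton (h : List (Report n)) (r : Report n) :
    withdraw i (h ++ [r]) = withdraw i h ++ [⟨r.interested.erase i, r.bid⟩] := by
  simp [withdraw]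

theorem weightedGreedy_withdraw (hy : ∀ k, k ≠ i → y k = y' k) (h : List (Report n))
    (r : Report n) : weightedGreedy y' (withdraw i (h ++ [r])) =
      argmax (r.interested.erase i \ matched y' (withdraw i h)) fun k => y k * r.bid k := by
  rw [withdraw_append_singleton, weightedGreedy_append_singleton]
  refine argmax_congr fun k hk => ?_
  rw [hy k (Finset.ne_of_mem_erase (Finset.mem_sdiff.1 hk).1)]

theorem matched_withdraw (h : List (Report n)) (r : Report n) :
    matched y' (withdraw i (h ++ [r])) =
      matched y' (withdraw i h) ∪ (weightedGreedy y' (withdraw i (h ++ [r]))).toFinset := by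
  rw [withdraw_append_singleton, matched_append_singleton]

/-- The presence of buyer `i` only makes more of the other buyers available. -/
theorem matched_subset_insert_withdraw (hy : ∀ k, k ≠ i → y k = y' k) (h : List (Report n)) :
    matched y h ⊆ insert i (matched y' (withdraw i h)) := by
  induction h using List.reverseRecOn with
  | nil => simp [matched]
  | append_singleton h r ih =>
    intro c hc
    rw [matched_withdraw, Finset.mem_insert, Finset.mem_union, Option.mem_toFinset, Option.mem_def]
    by_cases hci : c = i
    · exact Or.inl hci
    right
    rcases (mem_matched_append_singleton _ _ _).1 hc with hc | hc
    · exact Or.inl ((Finset.mem_insert.1 (ih hc)).resolve_left hci)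
    · by_cases hcS : c ∈ matched y' (withdraw i h)
      · exact Or.inl hcS
      right
      have hint := mem_interested_of_weightedGreedy_eq_some _ _ _ hc
      rw [weightedGreedy_append_singleton] at hc
      rw [weightedGreedy_withdraw hy]
      -- By induction, the candidates of the run without `i` are among those of the run with `i`.
      refine argmax_of_subset (fun k hk => ?_) hc ?_
      · simp only [Finset.mem_sdiff, Finset.mem_erase] at hk ⊢
        exact ⟨hk.1.2, fun hk' => (Finset.mem_insert.1 (ih hk')).elim hk.1.1 hk.2⟩
      · exact Finset.mem_sdiff.2 ⟨Finset.mem_erase.2 ⟨hci, hint.1⟩, hcS⟩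

/-- As long as buyer `i` has no item, her presence changes nothing. -/
theorem matched_eq_withdraw (hy : ∀ k, k ≠ i → y k = y' k) (h : List (Report n))
    (hi : i ∉ matched y h) : matched y h = matched y' (withdraw i h) := by
  induction h using List.reverseRecOn with
  | nil => simp [matched, withdraw]
  | append_singleton h r ih =>
    rw [mem_matched_append_singleton, not_or] at hi
    rw [matched_withdraw, matched_append_singleton, ← ih hi.1]
    congr 2
    rw [weightedGreedy_withdraw hy, ← ih hi.1]
    have hw := hi.2
    rw [weightedGreedy_append_singleton] at hw ⊢
    have hsub : r.interested.erase i \ matched y h ⊆ r.interested \ matched y h :=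
      Finset.sdiff_subset_sdiff (Finset.erase_subset _ _) subset_rfl
    symm
    cases hc : argmax (r.interested \ matched y h) fun k => y k * r.bid k with
    | none =>
      rw [argmax_eq_none_iff] at hc ⊢
      exact Finset.subset_empty.1 (hc ▸ hsub)
    | some c =>
      refine argmax_of_subset hsub hc ?_
      have hcm := Finset.mem_sdiff.1 (argmax_eq_some_iff.1 hc).1
      refine Finset.mem_sdiff.2 ⟨Finset.mem_erase.2 ⟨?_, hcm.1⟩, hcm.2⟩
      rintro rfl
      exact hw hc

/-- The score with which the item with report `r` is assigned (`0` if it is not assigned). -/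
def winningScore (y : Fin n → ℝ) (r : Report n) (o : Option (Fin n)) : ℝ :=
  o.elim 0 fun k => y k * r.bid k

theorem winningScore_nonneg (hy : ∀ k, 0 ≤ y k) (r : Report n) (o : Option (Fin n)) :
    0 ≤ winningScore y r o := by
  cases o with
  | none => exact le_rfl
  | some k => exact mul_nonneg (hy k) (r.bid k).2

theorem le_winningScore_argmax {r : Report n} {S : Finset (Fin n)} {k : Fin n} (hk : k ∈ S) :
    y k * r.bid k ≤ winningScore y r (argmax S fun l => y l * r.bid l) := by
  cases hc : argmax S fun l => y l * (r.bid l : ℝ) with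
  | none => rw [argmax_eq_none_iff] at hc; simp [hc] at hk
  | some c => exact le_of_argmax_eq_some hc hk

/-- The winner without `i` is still a candidate when `i` is present, by
`matched_subset_insert_withdraw`, and the rule picks the best candidate. -/
theorem winningScore_withdraw_le (hy : ∀ k, k ≠ i → y k = y' k) (hy0 : ∀ k, 0 ≤ y k)
    (h : List (Report n)) (r : Report n) :
    winningScore y' r (weightedGreedy y' (withdraw i (h ++ [r]))) ≤
      winningScore y r (weightedGreedy y (h ++ [r])) := by
  rw [weightedGreedy_withdraw hy]
  cases hc : argmax (r.interested.erase i \ matched y' (withdraw i h))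
    fun l => y l * (r.bid l : ℝ) with
  | none => exact winningScore_nonneg hy0 _ _
  | some c =>
    have hcm := (argmax_eq_some_iff.1 hc).1
    simp only [Finset.mem_sdiff, Finset.mem_erase] at hcm
    rw [weightedGreedy_append_singleton]
    change y' c * _ ≤ _
    rw [← hy c hcm.1.1]
    exact le_winningScore_argmax (Finset.mem_sdiff.2 ⟨hcm.1.2, fun hc' =>
      (Finset.mem_insert.1 (matched_subset_insert_withdraw hy h hc')).elim hcm.1.1 hcm.2⟩)

/-- While `i` is unserved the two runs agree, so the item goes to the same buyer, who has beaten
`i`. It is used in contrapositive form: a score above the one reached without `i` guarantees her an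
item by this time. -/
theorem le_winningScore_withdraw (hy : ∀ k, k ≠ i → y k = y' k) {h : List (Report n)}
    {r : Report n} (hr : i ∈ r.interested) (hi : i ∉ matched y (h ++ [r])) :
    y i * r.bid i ≤ winningScore y' r (weightedGreedy y' (withdraw i (h ++ [r]))) := by
  have hi' := hi
  rw [mem_matched_append_singleton, not_or, weightedGreedy_append_singleton] at hi'
  rw [weightedGreedy_withdraw hy, ← matched_eq_withdraw hy h hi'.1]
  have hmem : i ∈ r.interested \ matched y h := Finset.mem_sdiff.2 ⟨hr, hi'.1⟩
  cases hc : argmax (r.interested \ matched y h) fun l => y l * (r.bid l : ℝ) with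
  | none => rw [argmax_eq_none_iff] at hc; simp [hc] at hmem
  | some c =>
    have hci : c ≠ i := by rintro rfl; exact hi'.2 hc
    have hcm := Finset.mem_sdiff.1 (argmax_eq_some_iff.1 hc).1
    refine (le_of_argmax_eq_some hc hmem).trans ?_
    rw [argmax_of_subset (Finset.sdiff_subset_sdiff (Finset.erase_subset _ _) subset_rfl) hc
      (Finset.mem_sdiff.2 ⟨Finset.mem_erase.2 ⟨hci, hcm.1⟩, hcm.2⟩)]
    change _ ≤ y' c * _
    rw [hy c hci]

end Withdraw

/-! ### Weak duality, and the ratio of Greedy. -/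

section Competitive

variable {E : BuyerItemGraph n m} {b v : Fin n → ℝ≥0}

open Classical in
theorem coe_welfare (A : OnlineRule n) (E : BuyerItemGraph n m) (v : Fin n → ℝ≥0) :
    (welfare A E v : ℝ) = ∑ i, if GetsDesired A E v i then (v i : ℝ) else 0 := by
  rw [welfare, NNReal.coe_sum]
  exact Finset.sum_congr rfl fun i _ => by split_ifs <;> rfl

open Classical in
/-- Every buyer gets at most one item, so that a sum over the items of weights of the winning
buyers is a sum over the buyers who get an item. -/
theorem IsMatchingRule.sum_items_eq {A : OnlineRule n} (hA : IsMatchingRule A)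
    (E : BuyerItemGraph n m) (b : Fin n → ℝ≥0) (w : Fin n → ℝ) :
    ∑ j : Fin m, ∑ k, (if assign A (reports E b) j = some k then w k else 0) =
      ∑ k, if GetsDesired A E b k then w k else 0 := by
  rw [Finset.sum_comm]
  refine Finset.sum_congr rfl fun k _ => ?_
  split_ifs with h
  · obtain ⟨j, hj⟩ := hA.getsDesired_iff.1 h
    rw [Finset.sum_eq_single j (fun l _ hl => if_neg fun hl' =>
      hl ((hA m E b).2 l j k hl' hj)) (by simp), if_pos hj]
  · refine Finset.sum_eq_zero fun j _ => if_neg fun hj => h (hA.getsDesired_iff.2 ⟨j, hj⟩)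

/-- Weak duality for weighted bipartite matching. -/
theorem mul_opt_le_of_edge_bound {c : ℝ} {p : Fin n → ℝ} {q : Fin m → ℝ} (hp : ∀ i, 0 ≤ p i)
    (hq : ∀ j, 0 ≤ q j) (hE : ∀ i j, (i, j) ∈ E → c * v i ≤ p i + q j) :
    c * opt E v ≤ ∑ i, p i + ∑ j, q j := by
  classical
  obtain ⟨M, hM, hopt⟩ : ∃ M ∈ E.powerset.filter IsMatching, opt E v = ∑ e ∈ M, v e.1 := by
    refine Finset.exists_mem_eq_sup _ ⟨∅, ?_⟩ _
    simp [IsMatching]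
  rw [Finset.mem_filter, Finset.mem_powerset] at hM
  -- In a matching both projections are injective, so no dual is charged twice.
  have h1 : Set.InjOn Prod.fst (M : Set (Fin n × Fin m)) :=
    fun e he f hf hef => hM.2 e he f hf (Or.inl hef)
  have h2 : Set.InjOn Prod.snd (M : Set (Fin n × Fin m)) :=
    fun e he f hf hef => hM.2 e he f hf (Or.inr hef)
  calc c * opt E v = ∑ e ∈ M, c * v e.1 := by rw [hopt, NNReal.coe_sum, Finset.mul_sum]
    _ ≤ ∑ e ∈ M, (p e.1 + q e.2) := Finset.sum_le_sum fun e he => hE _ _ (hM.1 he)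
    _ = ∑ i ∈ M.image Prod.fst, p i + ∑ j ∈ M.image Prod.snd, q j := by
      rw [Finset.sum_add_distrib, Finset.sum_image h1, Finset.sum_image h2]
    _ ≤ ∑ i, p i + ∑ j, q j :=
      add_le_add (Finset.sum_le_univ_sum_of_nonneg hp) (Finset.sum_le_univ_sum_of_nonneg hq)

theorem winningScore_assign (y : Fin n → ℝ) (j : Fin m) :
    winningScore y (itemReport E b j) (assign (weightedGreedy y) (reports E b) j) =
      ∑ k, if assign (weightedGreedy y) (reports E b) j = some k then y k * b k else 0 := by
  cases hc : assign (weightedGreedy y) (reports E b) j with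
  | none => simp [winningScore]
  | some c =>
    have hcE := (isMatchingRule_weightedGreedy y m E b).1 j c hc
    simp [winningScore, bid_itemReport hcE]

theorem notMem_matched_take {y : Fin n → ℝ} {i : Fin n}
    (hi : ¬ GetsDesired (weightedGreedy y) E b i) (j : ℕ) :
    i ∉ matched y ((reports E b).take j) := by
  rw [(isMatchingRule_weightedGreedy y).getsDesired_iff_wins, ← mem_matched_iff_wins] at hi
  rw [← List.take_length (l := reports E b)] at hi
  rcases le_total j (reports E b).length with hj | hj
  · exact fun h => hi (matched_take_mono y _ hj h)
  · rwa [List.take_of_length_le hj, ← List.take_length (l := reports E b)]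

/-- The buyer duals and the item duals each sum to the welfare. If `i` is never served, she was
available when `j` arrived, so `j` went to a buyer of value at least `v i`. -/
theorem isCompetitive_greedy (n : ℕ) : IsCompetitive 2 (greedy n) := by
  classical
  intro m E v
  have hA : IsMatchingRule (greedy n) := isMatchingRule_weightedGreedy _
  have key := mul_opt_le_of_edge_bound (E := E) (v := v) (c := 1)
    (p := fun i => if GetsDesired (greedy n) E v i then (v i : ℝ) else 0)
    (q := fun j => ∑ k, if assign (greedy n) (reports E v) j = some k then (v k : ℝ) else 0)
    (fun i => by positivity) (fun j => Finset.sum_nonneg fun k _ => by positivity) ?_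
  · rw [hA.sum_items_eq, ← coe_welfare] at key
    linarith
  · intro i j hij
    have hq : (0 : ℝ) ≤ ∑ k, if assign (greedy n) (reports E v) j = some k then (v k : ℝ) else 0 :=
      Finset.sum_nonneg fun k _ => by positivity
    split_ifs with hi
    · linarith
    · have h1 := winningScore_assign (E := E) (b := v) (fun _ => (1 : ℝ)) j
      simp only [one_mul] at h1
      have h2 : (1 : ℝ) * (itemReport E v j).bid i ≤ _ :=
        le_winningScore_argmax (y := fun _ => (1 : ℝ)) (r := itemReport E v j)
          (Finset.mem_sdiff.2 ⟨(mem_interested_itemReport (b := v)).2 hij, notMem_matched_take hi j⟩)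
      rw [← weightedGreedy_append_singleton, ← assign_weightedGreedy, h1,
        bid_itemReport hij] at h2
      rw [zero_add]
      exact h2

end Competitive

/-! ### Measurability and integrability of the welfare. -/

section Randomized

variable {Ω : Type*} [MeasurableSpace Ω] {A : Ω → OnlineRule n}

theorem IsRandomizedMatchingRule.measurableSet_getsDesired (hA : IsRandomizedMatchingRule A)
    (E : BuyerItemGraph n m) (b : Fin n → ℝ≥0) (i : Fin n) :
    MeasurableSet {ω | GetsDesired (A ω) E b i} := by
  have : {ω | GetsDesired (A ω) E b i} =
      ⋃ j : Fin m, {ω | A ω ((reports E b).take (j + 1)) = some i} := by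
    ext ω
    rw [Set.mem_ofPred_eq, (hA.1 ω).getsDesired_iff, Set.mem_iUnion]
    rfl
  rw [this]
  exact MeasurableSet.iUnion fun j => hA.2 _ _

theorem IsRandomizedMatchingRule.measurable_welfare (hA : IsRandomizedMatchingRule A)
    (E : BuyerItemGraph n m) (v : Fin n → ℝ≥0) :
    Measurable fun ω => (welfare (A ω) E v : ℝ) := by
  classical
  simp only [coe_welfare]
  exact Finset.measurable_sum _ fun i _ =>
    Measurable.ite (hA.measurableSet_getsDesired E v i) measurable_const measurable_const

theorem welfare_le_sum (A : OnlineRule n) (E : BuyerItemGraph n m) (v : Fin n → ℝ≥0) :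
    welfare A E v ≤ ∑ i, v i := by
  classical
  exact Finset.sum_le_sum fun i _ => by split_ifs <;> simp

theorem IsRandomizedMatchingRule.integrable_welfare (hA : IsRandomizedMatchingRule A)
    (P : Measure Ω) [IsFiniteMeasure P] (E : BuyerItemGraph n m) (v : Fin n → ℝ≥0) :
    Integrable (fun ω => (welfare (A ω) E v : ℝ)) P := by
  refine Integrable.of_bound (hA.measurable_welfare E v).aestronglyMeasurable
    (∑ i, (v i : ℝ)) (Filter.Eventually.of_forall fun ω => ?_)
  rw [Real.norm_of_nonneg (NNReal.coe_nonneg _), ← NNReal.coe_sum]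
  exact NNReal.coe_le_coe.2 (welfare_le_sum _ _ _)

end Randomized

/-! ### Redrawing one coordinate of an i.i.d. sample. -/

section Resample

variable {ι : Type*} [Fintype ι] [DecidableEq ι] {α : Type*} [MeasureSpace α]
  [IsProbabilityMeasure (volume : Measure α)]

/-- Drawing one coordinate again does not change the distribution of an i.i.d. sample. -/
theorem measurePreserving_update (i : ι) :
    MeasurePreserving (fun p : (ι → α) × α => Function.update p.1 i p.2) volume volume := by
  have hmeas : Measurable fun p : (ι → α) × α => Function.update p.1 i p.2 := by
    refine measurable_pi_lambda _ fun k => ?_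
    by_cases hk : k = i
    · subst hk
      simpa using measurable_snd
    · simp only [ne_eq, hk, not_false_eq_true, Function.update_of_ne]
      exact (measurable_pi_apply k).comp measurable_fst
  refine ⟨hmeas, (Measure.pi_eq fun s hs => ?_).symm⟩
  rw [Measure.map_apply hmeas (MeasurableSet.univ_pi hs)]
  -- It suffices to test boxes: the discarded coordinate becomes free, and the new one takes over
  -- the constraint `s i`.
  have hpre : (fun p : (ι → α) × α => Function.update p.1 i p.2) ⁻¹' Set.univ.pi s =
      (Set.univ.pi (Function.update s i Set.univ)) ×ˢ s i := by
    ext p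
    simp only [Set.mem_preimage, Set.mem_univ_pi, Set.mem_prod]
    constructor
    · intro h
      refine ⟨fun k => ?_, by simpa using h i⟩
      by_cases hk : k = i
      · subst hk; simp
      · simpa [hk] using h k
    · rintro ⟨h1, h2⟩ k
      by_cases hk : k = i
      · subst hk; simpa using h2
      · simpa [hk] using h1 k
  rw [hpre, Measure.volume_eq_prod, Measure.prod_prod, volume_pi_pi,
    ← Finset.mul_prod_erase _ _ (Finset.mem_univ i), ← Finset.mul_prod_erase Finset.univ
      (fun k => volume (s k)) (Finset.mem_univ i), Function.update_self, measure_univ, one_mul,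
    mul_comm]
  congr 1
  exact Finset.prod_congr rfl fun k hk => by
    rw [Function.update_of_ne (Finset.ne_of_mem_erase hk)]

/-- This replaces conditioning on the other coordinates: the `i`-th entry of `x` is overwritten, and
Fubini integrates the bound over the rest. -/
theorem le_integral_of_forall_le_integral_update {F : (ι → α) → ℝ} (hF : Measurable F) {C c : ℝ}
    (hC : ∀ x, ‖F x‖ ≤ C) (i : ι) (h : ∀ x, c ≤ ∫ t, F (Function.update x i t)) :
    c ≤ ∫ x, F x := by
  have hmp := measurePreserving_update (α := α) i
  have hint : Integrable (fun p : (ι → α) × α => F (Function.update p.1 i p.2)) volume :=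
    Integrable.of_bound (hF.comp hmp.measurable).aestronglyMeasurable C
      (Filter.Eventually.of_forall fun p => hC _)
  have hFmap : ∫ x, F x = ∫ p : (ι → α) × α, F (Function.update p.1 i p.2) := by
    rw [← integral_map hmp.measurable.aemeasurable (hF.aestronglyMeasurable), hmp.map_eq]
  rw [hFmap, Measure.volume_eq_prod, integral_prod _ hint]
  calc c = ∫ _ : ι → α, c := by simp
    _ ≤ _ := integral_mono (integrable_const c) hint.integral_prod_left h

end Resample

/-! ### The one-variable integral that produces `1 - 1/e`. -/

/-- The expected dual value of an edge, when the competing score is `s`. -/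
theorem mul_le_integral_dual {v s : ℝ} (hv : 0 ≤ v) (hs : 0 ≤ s) :
    (1 - Real.exp (-1)) * v ≤ ∫ t : unitInterval,
      (s + if s < (1 - Real.exp ((t : ℝ) - 1)) * v then Real.exp ((t : ℝ) - 1) * v else 0) := by
  set G : ℝ → ℝ := fun t => if s < (1 - Real.exp (t - 1)) * v then Real.exp (t - 1) * v else 0
    with hG
  have hGm : Measurable G := by
    refine Measurable.ite (measurableSet_lt measurable_const (by fun_prop)) (by fun_prop)
      measurable_const
  have hG0 : ∀ t, 0 ≤ G t := fun t => by
    simp only [hG]; split_ifs <;> positivity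
  have hGi : Integrable (fun t : unitInterval => G t) := by
    refine Integrable.of_bound (hGm.comp measurable_subtype_coe).aestronglyMeasurable v
      (Filter.Eventually.of_forall fun t => ?_)
    rw [Real.norm_of_nonneg (hG0 t)]
    simp only [hG]
    split_ifs
    · have : Real.exp ((t : ℝ) - 1) ≤ 1 := Real.exp_le_one_iff.2 (by linarith [t.2.2])
      nlinarith
    · exact hv
  change _ ≤ ∫ t : unitInterval, (s + G t)
  rw [integral_add (integrable_const _) hGi]
  have hsint : ∫ _ : unitInterval, s = s := by simp
  rw [hsint]
  -- For large `s` the item's share alone suffices, and the threshold `c` below would not be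
  -- positive.
  rcases le_or_gt ((1 - Real.exp (-1)) * v) s with hle | hlt
  · have : 0 ≤ ∫ t : unitInterval, G t := integral_nonneg_of_ae
      (Filter.Eventually.of_forall fun t => hG0 t)
    linarith
  have hv0 : 0 < v := by
    rcases hv.lt_or_eq with h | h
    · exact h
    · rw [← h] at hlt; linarith
  have hexp : Real.exp (-1) < 1 - s / v := by
    have : s / v < 1 - Real.exp (-1) := by rwa [div_lt_iff₀ hv0]
    linarith
  have hpos : 0 < 1 - s / v := (Real.exp_pos _).trans hexp
  -- `c` is the perturbation at which the buyer's score equals `s`; she beats `s` exactly for `t <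
  -- c`.
  set c := 1 + Real.log (1 - s / v) with hc
  have hc0 : 0 < c := by
    have := (Real.lt_log_iff_exp_lt hpos).2 hexp
    linarith
  have hc1 : c ≤ 1 := by
    have : Real.log (1 - s / v) ≤ 0 :=
      Real.log_nonpos hpos.le (by linarith [div_nonneg hs hv])
    linarith
  have hcexp : Real.exp (c - 1) = 1 - s / v := by
    rw [hc, add_sub_cancel_left, Real.exp_log hpos]
  have hGon : IntegrableOn G (Set.Icc 0 1) :=
    (integrableOn_iff_comap_subtypeVal measurableSet_Icc).2 hGi
  have h1 : ∫ t : unitInterval, G t = ∫ t in Set.Icc (0 : ℝ) 1, G t :=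
    integral_subtype measurableSet_Icc G
  have h2 : ∫ t in Set.Ioo (0 : ℝ) c, G t ≤ ∫ t in Set.Icc (0 : ℝ) 1, G t :=
    setIntegral_mono_set hGon (Filter.Eventually.of_forall hG0)
      (Set.Ioo_subset_Icc_self.trans (Set.Icc_subset_Icc_right hc1)).eventuallyLE
  have h3 : ∫ t in Set.Ioo (0 : ℝ) c, G t = ∫ t in (0 : ℝ)..c, Real.exp (t - 1) * v := by
    rw [intervalIntegral.integral_of_le hc0.le, integral_Ioc_eq_integral_Ioo]
    refine setIntegral_congr_fun measurableSet_Ioo fun t ht => ?_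
    simp only [hG]
    rw [if_pos]
    have : Real.exp (t - 1) < 1 - s / v := by
      rw [← hcexp]; exact Real.exp_lt_exp.2 (by linarith [ht.2])
    have h4 : s / v < 1 - Real.exp (t - 1) := by linarith
    rwa [div_lt_iff₀ hv0] at h4
  have h5 : ∫ t in (0 : ℝ)..c, Real.exp (t - 1) * v = (1 - s / v - Real.exp (-1)) * v := by
    rw [intervalIntegral.integral_mul_const, intervalIntegral.integral_comp_sub_right
      (fun t => Real.exp t), integral_exp, hcexp, zero_sub]
  -- The buyer's expected share falls linearly in `s` with slope `-1`, which cancels the item's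
  -- share `s`.
  have h6 : (1 - s / v - Real.exp (-1)) * v = (1 - Real.exp (-1)) * v - s := by
    field_simp
    ring
  linarith

/-! ### Measurability of the greedy decisions in the multipliers. -/

section Measurability

variable {Ω : Type*} [MeasurableSpace Ω] {y : Ω → Fin n → ℝ}

theorem measurableSet_argmax_eq {f : Ω → Fin n → ℝ} (hf : ∀ k, Measurable fun ω => f ω k)
    (S : Finset (Fin n)) (c : Option (Fin n)) : MeasurableSet {ω | argmax S (f ω) = c} := by
  cases c with
  | none => simp only [argmax_eq_none_iff]; exact MeasurableSet.const _
  | some i =>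
    simp only [argmax_eq_some_iff]
    refine (MeasurableSet.const _).inter ?_
    have : {ω | ∀ k ∈ S, f ω k < f ω i ∨ f ω k = f ω i ∧ i ≤ k} =
        ⋂ k ∈ S, ({ω | f ω k < f ω i} ∪ ({ω | f ω k = f ω i} ∩ {_ω | i ≤ k})) := by
      ext ω; simp
    change MeasurableSet {ω | ∀ k ∈ S, f ω k < f ω i ∨ f ω k = f ω i ∧ i ≤ k}
    rw [this]
    exact Finset.measurableSet_biInter _ fun k _ => (measurableSet_lt (hf k) (hf i)).union
      ((measurableSet_eq_fun (hf k) (hf i)).inter (MeasurableSet.const _))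

/-- Once the set of served buyers is fixed, the decision is an argmax of measurable scores over a
fixed set; there are only finitely many such sets. -/
theorem measurableSet_matched_and_assigned (hy : ∀ k, Measurable fun ω => y ω k)
    {h : List (Report n)} (hh : ∀ S, MeasurableSet {ω | matched (y ω) h = S}) (r : Report n)
    (S : Finset (Fin n)) (c : Option (Fin n)) :
    MeasurableSet {ω | matched (y ω) h = S ∧ weightedGreedy (y ω) (h ++ [r]) = c} := by
  have : {ω | matched (y ω) h = S ∧ weightedGreedy (y ω) (h ++ [r]) = c} =
      {ω | matched (y ω) h = S} ∩
        {ω | argmax (r.interested \ S) (fun i => y ω i * r.bid i) = c} := by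
    ext ω
    refine and_congr_right fun hS => ?_
    rw [weightedGreedy_append_singleton, hS]
    rfl
  rw [this]
  exact (hh S).inter (measurableSet_argmax_eq (fun k => (hy k).mul_const _) _ _)

theorem measurableSet_matched_eq (hy : ∀ k, Measurable fun ω => y ω k) (h : List (Report n))
    (S : Finset (Fin n)) : MeasurableSet {ω | matched (y ω) h = S} := by
  induction h using List.reverseRecOn generalizing S with
  | nil => exact MeasurableSet.const (∅ = S)
  | append_singleton h r ih =>
    have : {ω | matched (y ω) (h ++ [r]) = S} = ⋃ T : Finset (Fin n), ⋃ c : Option (Fin n),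
        {ω | matched (y ω) h = T ∧ weightedGreedy (y ω) (h ++ [r]) = c} ∩
          {_ω | T ∪ c.toFinset = S} := by
      ext ω; simp [matched_append_singleton]
    rw [this]
    exact MeasurableSet.iUnion fun T => MeasurableSet.iUnion fun c =>
      (measurableSet_matched_and_assigned hy ih r T c).inter (MeasurableSet.const _)

theorem measurableSet_weightedGreedy_eq (hy : ∀ k, Measurable fun ω => y ω k)
    (h : List (Report n)) (c : Option (Fin n)) :
    MeasurableSet {ω | weightedGreedy (y ω) h = c} := by
  cases h using List.reverseRecOn with
  | nil => exact MeasurableSet.const (none = c)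
  | append_singleton h r =>
    have : {ω | weightedGreedy (y ω) (h ++ [r]) = c} = ⋃ T : Finset (Fin n),
        {ω | matched (y ω) h = T ∧ weightedGreedy (y ω) (h ++ [r]) = c} := by
      ext ω; simp
    rw [this]
    exact MeasurableSet.iUnion fun T =>
      measurableSet_matched_and_assigned hy (measurableSet_matched_eq hy h) r T c

end Measurability

/-- The multipliers of Perturbed-Greedy. -/
noncomputable def multiplier (x : Fin n → unitInterval) (i : Fin n) : ℝ :=
  1 - Real.exp ((x i : ℝ) - 1)

theorem multiplier_nonneg (x : Fin n → unitInterval) (i : Fin n) : 0 ≤ multiplier x i :=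
  sub_nonneg.2 (Real.exp_le_one_iff.2 (by linarith [(x i).2.2]))

theorem multiplier_le_one (x : Fin n → unitInterval) (i : Fin n) : multiplier x i ≤ 1 :=
  sub_le_self _ (Real.exp_pos _).le

theorem measurable_multiplier (i : Fin n) :
    Measurable fun x : Fin n → unitInterval => multiplier x i := by
  unfold multiplier
  have : Measurable fun x : Fin n → unitInterval => ((x i : unitInterval) : ℝ) :=
    measurable_subtype_coe.comp (measurable_pi_apply i)
  fun_prop

theorem isRandomizedMatchingRule_perturbedGreedy (n : ℕ) :
    IsRandomizedMatchingRule (perturbedGreedy n) :=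
  ⟨fun _ => isMatchingRule_weightedGreedy _,
    fun h c => measurableSet_weightedGreedy_eq measurable_multiplier h c⟩

/-! ### Random duals, and the ratio of Perturbed-Greedy. -/

section Dual

variable (E : BuyerItemGraph n m) (v : Fin n → ℝ≥0)

open Classical in
/-- The dual variable of buyer `i`: her share of the value of her edge. -/
noncomputable def buyerDual (x : Fin n → unitInterval) (i : Fin n) : ℝ :=
  if GetsDesired (perturbedGreedy n x) E v i then (1 - multiplier x i) * v i else 0

/-- The dual variable of item `j`: its share of the value of its edge. -/
noncomputable def itemDual (x : Fin n → unitInterval) (j : Fin m) : ℝ :=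
  ∑ k, if assign (perturbedGreedy n x) (reports E v) j = some k then multiplier x k * v k else 0

theorem measurable_buyerDual (i : Fin n) : Measurable fun x => buyerDual E v x i := by
  classical
  exact Measurable.ite ((isRandomizedMatchingRule_perturbedGreedy n).measurableSet_getsDesired E v i)
    (((measurable_multiplier i).const_sub 1).mul_const _) measurable_const

theorem measurable_itemDual (j : Fin m) : Measurable fun x => itemDual E v x j :=
  Finset.measurable_sum _ fun k _ =>
    Measurable.ite ((isRandomizedMatchingRule_perturbedGreedy n).2 _ _)
      ((measurable_multiplier k).mul_const _) measurable_const

theorem buyerDual_nonneg (x : Fin n → unitInterval) (i : Fin n) : 0 ≤ buyerDual E v x i := by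
  unfold buyerDual
  split_ifs
  · exact mul_nonneg (sub_nonneg.2 (multiplier_le_one x i)) (v i).2
  · exact le_rfl

theorem itemDual_nonneg (x : Fin n → unitInterval) (j : Fin m) : 0 ≤ itemDual E v x j := by
  refine Finset.sum_nonneg fun k _ => ?_
  split_ifs
  · exact mul_nonneg (multiplier_nonneg x k) (v k).2
  · exact le_rfl

theorem sum_buyerDual_add_sum_itemDual (x : Fin n → unitInterval) :
    ∑ i, buyerDual E v x i + ∑ j, itemDual E v x j = welfare (perturbedGreedy n x) E v := by
  classical
  have hA : IsMatchingRule (perturbedGreedy n x) := isMatchingRule_weightedGreedy _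
  unfold buyerDual itemDual
  rw [hA.sum_items_eq E v fun k => multiplier x k * v k, coe_welfare, ← Finset.sum_add_distrib]
  refine Finset.sum_congr rfl fun i _ => ?_
  split_ifs <;> ring

/-- A single dual is a nonnegative summand of the welfare; this uniform bound serves for
integrability. -/
theorem buyerDual_le_welfare (x : Fin n → unitInterval) (i : Fin n) :
    buyerDual E v x i ≤ ∑ k, (v k : ℝ) := by
  have h1 := Finset.single_le_sum (fun k _ => buyerDual_nonneg E v x k) (Finset.mem_univ i)
  have h2 := Finset.sum_nonneg fun j (_ : j ∈ Finset.univ) => itemDual_nonneg E v x j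
  have h3 := sum_buyerDual_add_sum_itemDual E v x
  have h4 : (welfare (perturbedGreedy n x) E v : ℝ) ≤ ∑ k, (v k : ℝ) := by
    rw [← NNReal.coe_sum]; exact NNReal.coe_le_coe.2 (welfare_le_sum _ _ _)
  linarith

theorem itemDual_le_welfare (x : Fin n → unitInterval) (j : Fin m) :
    itemDual E v x j ≤ ∑ k, (v k : ℝ) := by
  have h1 := Finset.single_le_sum (fun k _ => itemDual_nonneg E v x k) (Finset.mem_univ j)
  have h2 := Finset.sum_nonneg fun i (_ : i ∈ Finset.univ) => buyerDual_nonneg E v x i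
  have h3 := sum_buyerDual_add_sum_itemDual E v x
  have h4 : (welfare (perturbedGreedy n x) E v : ℝ) ≤ ∑ k, (v k : ℝ) := by
    rw [← NNReal.coe_sum]; exact NNReal.coe_le_coe.2 (welfare_le_sum _ _ _)
  linarith

theorem integrable_buyerDual (i : Fin n) : Integrable fun x => buyerDual E v x i :=
  Integrable.of_bound (measurable_buyerDual E v i).aestronglyMeasurable (∑ k, (v k : ℝ))
    (Filter.Eventually.of_forall fun x => by
      rw [Real.norm_of_nonneg (buyerDual_nonneg E v x i)]; exact buyerDual_le_welfare E v x i)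

theorem integrable_itemDual (j : Fin m) : Integrable fun x => itemDual E v x j :=
  Integrable.of_bound (measurable_itemDual E v j).aestronglyMeasurable (∑ k, (v k : ℝ))
    (Filter.Eventually.of_forall fun x => by
      rw [Real.norm_of_nonneg (itemDual_nonneg E v x j)]; exact itemDual_le_welfare E v x j)

variable {E v}

/-- The duals of an edge as a function of the perturbation of its buyer: the item keeps at least
its score without the buyer, and the buyer is matched when she beats that score. -/
theorem exists_score_le_dual {i : Fin n} {j : Fin m} (hij : (i, j) ∈ E)
    (x : Fin n → unitInterval) : ∃ s : ℝ, 0 ≤ s ∧ ∀ t : unitInterval,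
      (s + if s < (1 - Real.exp ((t : ℝ) - 1)) * v i then Real.exp ((t : ℝ) - 1) * v i else 0) ≤
        buyerDual E v (Function.update x i t) i + itemDual E v (Function.update x i t) j := by
  -- The score of item `j` in the run without `i`. It is computed from `x` before `t` is chosen,
  -- which is legitimate because `x` and its update agree off `i`.
  refine ⟨winningScore (multiplier x) (itemReport E v j) (weightedGreedy (multiplier x)
    (withdraw i ((reports E v).take j ++ [itemReport E v j]))),
    winningScore_nonneg (multiplier_nonneg x) _ _, fun t => ?_⟩
  set x' := Function.update x i t with hx'
  have hyi : multiplier x' i = 1 - Real.exp ((t : ℝ) - 1) := by simp [multiplier, hx']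
  have hy : ∀ k, k ≠ i → multiplier x' k = multiplier x k := fun k hk => by
    simp [multiplier, hx', hk]
  have hitem : itemDual E v x' j = winningScore (multiplier x') (itemReport E v j)
      (weightedGreedy (multiplier x') ((reports E v).take j ++ [itemReport E v j])) := by
    rw [← assign_weightedGreedy, winningScore_assign]
    rfl
  rw [add_comm (buyerDual _ _ _ _), hitem]
  refine add_le_add (winningScore_withdraw_le hy (multiplier_nonneg x') _ _) ?_
  split_ifs with hs
  · have hg : GetsDesired (perturbedGreedy n x') E v i := by
      by_contra hg
      have hm := notMem_matched_take (y := multiplier x') hg (j + 1)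
      rw [take_succ_reports] at hm
      have := le_winningScore_withdraw hy (mem_interested_itemReport.2 hij) hm
      rw [bid_itemReport hij, hyi] at this
      exact absurd hs (not_lt.2 this)
    rw [buyerDual, if_pos hg, hyi, sub_sub_cancel]
  · exact buyerDual_nonneg _ _ _ _

theorem le_integral_dual {i : Fin n} {j : Fin m} (hij : (i, j) ∈ E) :
    (1 - Real.exp (-1)) * v i ≤ (∫ x, buyerDual E v x i) + ∫ x, itemDual E v x j := by
  rw [← integral_add (integrable_buyerDual E v i) (integrable_itemDual E v j)]
  have hmeas : Measurable fun x => buyerDual E v x i + itemDual E v x j :=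
    (measurable_buyerDual E v i).add (measurable_itemDual E v j)
  have hbound : ∀ x, ‖buyerDual E v x i + itemDual E v x j‖ ≤
      (∑ k, (v k : ℝ)) + ∑ k, (v k : ℝ) := fun x => by
    rw [Real.norm_of_nonneg (add_nonneg (buyerDual_nonneg E v x i) (itemDual_nonneg E v x j))]
    exact add_le_add (buyerDual_le_welfare E v x i) (itemDual_le_welfare E v x j)
  refine le_integral_of_forall_le_integral_update hmeas hbound i fun x => ?_
  obtain ⟨s, hs0, hs⟩ := exists_score_le_dual (v := v) hij x
  refine (mul_le_integral_dual (v i).2 hs0).trans ?_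
  refine integral_mono_of_nonneg (Filter.Eventually.of_forall fun t => ?_)
    (Integrable.of_bound (hmeas.comp (measurable_update x)).aestronglyMeasurable _
      (Filter.Eventually.of_forall fun t => hbound _)) (Filter.Eventually.of_forall hs)
  change (0 : ℝ) ≤ s + _
  have := (v i).2
  split_ifs <;> positivity

/-- Only the expected duals need to cover the edges: they sum to the expected welfare, and they
cover each edge up to the factor `1 - 1/e`. -/
theorem isCompetitiveInExpectation_perturbedGreedy (n : ℕ) :
    IsCompetitiveInExpectation (Real.exp 1 / (Real.exp 1 - 1))
      (volume : Measure (Fin n → unitInterval)) (perturbedGreedy n) := by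
  intro m E v
  have key := mul_opt_le_of_edge_bound (E := E) (v := v) (c := 1 - Real.exp (-1))
    (p := fun i => ∫ x, buyerDual E v x i) (q := fun j => ∫ x, itemDual E v x j)
    (fun i => integral_nonneg fun x => buyerDual_nonneg E v x i)
    (fun j => integral_nonneg fun x => itemDual_nonneg E v x j) fun i j hij => le_integral_dual hij
  rw [← integral_finsetSum _ fun i _ => integrable_buyerDual E v i,
    ← integral_finsetSum _ fun j _ => integrable_itemDual E v j,
    ← integral_add (integrable_finsetSum _ fun i _ => integrable_buyerDual E v i)
      (integrable_finsetSum _ fun j _ => integrable_itemDual E v j)] at key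
  simp only [sum_buyerDual_add_sum_itemDual] at key
  change _ ≤ expectedWelfare volume (perturbedGreedy n) E v at key
  have he : 1 < Real.exp 1 := Real.one_lt_exp_iff.2 one_pos
  rw [Real.exp_neg] at key
  rw [div_mul_eq_mul_div, le_div_iff₀ (by linarith)]
  have h2 : (1 - (Real.exp 1)⁻¹) * Real.exp 1 = Real.exp 1 - 1 := by field_simp
  nlinarith [mul_le_mul_of_nonneg_left key (Real.exp_pos 1).le]

end Dual

/-! ### The deterministic lower bound. -/

/-- A perfect matching of the buyers bounds the optimum from below. -/
theorem sum_le_opt {E : BuyerItemGraph n m} {v : Fin n → ℝ≥0} {f : Fin n → Fin m}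
    (hf : Function.Injective f) (hE : ∀ i, (i, f i) ∈ E) : ∑ i, v i ≤ opt E v := by
  classical
  have hinj : Function.Injective fun i => (i, f i) := fun a b h => (Prod.mk.inj h).1
  have hM : Finset.univ.image (fun i => (i, f i)) ∈ E.powerset.filter IsMatching := by
    rw [Finset.mem_filter, Finset.mem_powerset]
    constructor
    · intro e he
      obtain ⟨i, -, rfl⟩ := Finset.mem_image.1 he
      exact hE i
    · intro e he e' he' h
      obtain ⟨i, -, rfl⟩ := Finset.mem_image.1 he
      obtain ⟨k, -, rfl⟩ := Finset.mem_image.1 he'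
      rcases h with h | h
      · exact congrArg (fun i => (i, f i)) h
      · exact congrArg (fun i => (i, f i)) (hf h)
  calc ∑ i, v i = ∑ e ∈ Finset.univ.image (fun i => (i, f i)), v e.1 := by
        rw [Finset.sum_image hinj.injOn]
    _ ≤ opt E v := Finset.le_sup (f := fun M : BuyerItemGraph n m => ∑ e ∈ M, v e.1) hM

/-- The graph in which both buyers want item `0` and only buyer `c` wants item `1`. -/
def forkGraph (c : Fin 2) : BuyerItemGraph 2 2 :=
  Finset.univ.filter fun e => e.2 = 0 ∨ e.1 = c

/-- The first item does not reveal `c`, so the adversary can fix `c` after seeing the first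
decision. -/
theorem take_one_reports_forkGraph (c c' : Fin 2) (v : Fin 2 → ℝ≥0) :
    (reports (forkGraph c) v).take 1 = (reports (forkGraph c') v).take 1 := by
  have := take_succ_reports (forkGraph c) v 0
  have h' := take_succ_reports (forkGraph c') v 0
  simp only [Fin.val_zero, zero_add, List.take_zero, List.nil_append] at this h'
  rw [this, h']
  simp [itemReport, forkGraph]

/-- The permutation `swap 1 c` gives item `1` to `c` and item `0` to the other buyer. -/
theorem opt_forkGraph (c : Fin 2) : 2 ≤ opt (forkGraph c) fun _ => 1 := by
  have h := sum_le_opt (E := forkGraph c) (v := fun _ => 1) (f := Equiv.swap 1 c)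
    (Equiv.injective _) (by fin_cases c <;> decide)
  simpa using h

/-- Let `c` be the buyer who gets the first item, or any buyer if there is none. The other buyer has
missed the only item she wants. -/
theorem exists_welfare_forkGraph_le (A : OnlineRule 2) :
    ∃ c, welfare A (forkGraph c) (fun _ => 1) ≤ 1 := by
  classical
  set v : Fin 2 → ℝ≥0 := fun _ => 1
  obtain ⟨c, hc⟩ : ∃ c : Fin 2, ∀ k, k ≠ c → assign A (reports (forkGraph c) v) 0 ≠ some k := by
    have h0 : ∀ c, assign A (reports (forkGraph c) v) 0 = assign A (reports (forkGraph 0) v) 0 :=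
      fun c => congrArg A (take_one_reports_forkGraph c 0 v)
    cases h : assign A (reports (forkGraph 0) v) 0 with
    | none => exact ⟨0, fun k _ => by rw [h]; simp⟩
    | some c => exact ⟨c, fun k hk => by rw [h0, h]; simpa using hk.symm⟩
  refine ⟨c, ?_⟩
  have hk : ∀ k, k ≠ c → ¬ GetsDesired A (forkGraph c) v k := by
    rintro k hk ⟨j, hj, hjE⟩
    rcases (Finset.mem_filter.1 hjE).2 with h | h
    · dsimp only at h
      subst h
      exact hc k hk hj
    · exact hk h
  unfold welfare
  rw [Finset.sum_eq_single c (fun k _ hkc => if_neg (hk k hkc)) (by simp)]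
  split_ifs <;> simp [v]

theorem deterministic_lower_bound {α : ℝ} (hα : α < 2) (A : OnlineRule 2) :
    ∃ E : BuyerItemGraph 2 2, α * welfare A E (fun _ => 1) < opt E fun _ => 1 := by
  obtain ⟨c, hc⟩ := exists_welfare_forkGraph_le A
  refine ⟨forkGraph c, ?_⟩
  have h2 : (2 : ℝ) ≤ opt (forkGraph c) fun _ => 1 := by exact_mod_cast opt_forkGraph c
  have h1 : (welfare A (forkGraph c) (fun _ => 1) : ℝ) ≤ 1 := by exact_mod_cast hc
  have h0 : (0 : ℝ) ≤ welfare A (forkGraph c) (fun _ => 1) := NNReal.coe_nonneg _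
  rcases le_or_gt α 0 with h | h <;> nlinarith

/-! ### Randomly ordered upper triangular graphs. -/

section UpperTriangular

/-- Item `j` is wanted by the buyers `σ j, σ (j + 1), …`. -/
def upperTriangular (σ : Equiv.Perm (Fin n)) : BuyerItemGraph n n :=
  Finset.univ.filter fun e => e.2 ≤ σ.symm e.1

theorem mem_upperTriangular {σ : Equiv.Perm (Fin n)} {i j : Fin n} :
    (i, j) ∈ upperTriangular σ ↔ j ≤ σ.symm i := by
  simp [upperTriangular]

theorem natCast_le_opt_upperTriangular (σ : Equiv.Perm (Fin n)) :
    (n : ℝ≥0) ≤ opt (upperTriangular σ) fun _ => 1 := by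
  have h := sum_le_opt (E := upperTriangular σ) (v := fun _ => 1) (f := σ.symm)
    σ.symm.injective fun i => mem_upperTriangular.2 le_rfl
  simpa using h

/-- Exchanging two buyers who have both been interested in all items so far is not visible. -/
theorem take_reports_upperTriangular_swap (σ : Equiv.Perm (Fin n)) {j k l : Fin n} (hk : j ≤ k)
    (hl : j ≤ l) (v : Fin n → ℝ≥0) :
    (reports (upperTriangular (σ * Equiv.swap k l)) v).take (j + 1) =
      (reports (upperTriangular σ) v).take (j + 1) := by
  refine List.ext_getElem (by simp [length_reports]) fun q hq _ => ?_
  have hqj : q ≤ j := by simp only [List.length_take] at hq; omega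
  have hqn : q < n := hqj.trans_lt j.2
  have hiff : ∀ i : Fin n, (i, (⟨q, hqn⟩ : Fin n)) ∈ upperTriangular (σ * Equiv.swap k l) ↔
      (i, (⟨q, hqn⟩ : Fin n)) ∈ upperTriangular σ := by
    intro i
    have hqj' : (⟨q, hqn⟩ : Fin n) ≤ j := hqj
    rw [mem_upperTriangular, mem_upperTriangular]
    change _ ≤ Equiv.swap k l (σ.symm i) ↔ _
    by_cases h1 : σ.symm i = k
    · rw [h1, Equiv.swap_apply_left]
      exact iff_of_true (hqj'.trans hl) (hqj'.trans hk)
    by_cases h2 : σ.symm i = l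
    · rw [h2, Equiv.swap_apply_right]
      exact iff_of_true (hqj'.trans hk) (hqj'.trans hl)
    rw [Equiv.swap_apply_of_ne_of_ne h1 h2]
  simp only [List.getElem_take, reports, List.getElem_ofFn, hiff]

variable (A : OnlineRule n)

/-- The number of the orders `σ` in which item `j` goes to buyer `σ k`. -/
def assignCount (j k : Fin n) : ℕ :=
  (Finset.univ.filter fun σ : Equiv.Perm (Fin n) =>
    assign A (reports (upperTriangular σ) fun _ => 1) j = some (σ k)).card

/-- Composing with `swap k l` moves the same buyer from position `k` to position `l` without
changing the reports up to item `j`, hence without changing the decision. -/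
theorem assignCount_eq {j k l : Fin n} (hk : j ≤ k) (hl : j ≤ l) :
    assignCount A j k = assignCount A j l := by
  refine Finset.card_bij (fun σ _ => σ * Equiv.swap k l) (fun σ hσ => ?_)
    (fun σ _ τ _ h => mul_right_cancel h) (fun σ hσ => ⟨σ * Equiv.swap k l, ?_, ?_⟩)
  · rw [Finset.mem_filter] at hσ ⊢
    refine ⟨Finset.mem_univ _, ?_⟩
    rw [assign, take_reports_upperTriangular_swap σ hk hl, Equiv.Perm.mul_apply,
      Equiv.swap_apply_right]
    exact hσ.2
  · rw [Finset.mem_filter] at hσ ⊢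
    refine ⟨Finset.mem_univ _, ?_⟩
    rw [assign, take_reports_upperTriangular_swap σ hk hl, Equiv.Perm.mul_apply,
      Equiv.swap_apply_left]
    exact hσ.2
  · rw [mul_assoc, Equiv.swap_mul_self, mul_one]

theorem assignCount_eq_sum (j k : Fin n) : assignCount A j k =
    ∑ σ : Equiv.Perm (Fin n),
      if assign A (reports (upperTriangular σ) fun _ => 1) j = some (σ k) then 1 else 0 := by
  rw [assignCount, Finset.card_filter]

/-- The `n - j` positions from `j` on have equal counts, and each order contributes to at most one
of them. -/
theorem sub_mul_assignCount_le (j : Fin n) :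
    (n - j : ℕ) * assignCount A j j ≤ n.factorial := by
  calc (n - j : ℕ) * assignCount A j j = ∑ k ∈ Finset.Ici j, assignCount A j k := by
        rw [Finset.sum_congr rfl fun k hk =>
          (assignCount_eq A le_rfl (Finset.mem_Ici.1 hk)).symm, Finset.sum_const, Fin.card_Ici,
          smul_eq_mul]
    _ = ∑ σ : Equiv.Perm (Fin n), ∑ k ∈ Finset.Ici j,
          if assign A (reports (upperTriangular σ) fun _ => 1) j = some (σ k) then 1 else 0 := by
        rw [Finset.sum_comm]
        exact Finset.sum_congr rfl fun k _ => assignCount_eq_sum A j k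
    _ ≤ ∑ _ : Equiv.Perm (Fin n), 1 := by
        refine Finset.sum_le_sum fun σ _ => ?_
        rw [← Finset.card_filter, Finset.card_le_one]
        intro a ha b hb
        have h := (Finset.mem_filter.1 ha).2.symm.trans (Finset.mem_filter.1 hb).2
        exact σ.injective (Option.some.inj h)
    _ = n.factorial := by simp [Fintype.card_perm]

variable {A}

/-- By symmetry, position `j` can be replaced by the last position, which is active at all times.
Its buyer gets at most one item. -/
theorem sum_assignCount_le (hA : IsMatchingRule A) (hn : 0 < n) : ∑ j, assignCount A j j ≤ n.factorial := by
  have hlast : ∀ j : Fin n, j ≤ ⟨n - 1, by omega⟩ := fun j => by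
    rw [Fin.le_def]; have := j.2; simp only; omega
  calc ∑ j, assignCount A j j = ∑ j, assignCount A j ⟨n - 1, by omega⟩ :=
        Finset.sum_congr rfl fun j _ => assignCount_eq A le_rfl (hlast j)
    _ = ∑ σ : Equiv.Perm (Fin n), ∑ j : Fin n, if assign A (reports (upperTriangular σ)
          fun _ => 1) j = some (σ ⟨n - 1, by omega⟩) then 1 else 0 := by
        rw [Finset.sum_comm]
        exact Finset.sum_congr rfl fun j _ => assignCount_eq_sum A j _
    _ ≤ ∑ _ : Equiv.Perm (Fin n), 1 := by
        refine Finset.sum_le_sum fun σ _ => ?_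
        rw [← Finset.card_filter, Finset.card_le_one]
        intro a ha b hb
        exact (hA n _ _).2 a b _ (Finset.mem_filter.1 ha).2 (Finset.mem_filter.1 hb).2
    _ = n.factorial := by simp [Fintype.card_perm]

/-- Item `j` can only go to the `n - j` positions from `j` on, and it goes to each of them in
equally many orders. -/
theorem sum_welfare_upperTriangular_eq (hA : IsMatchingRule A) :
    ∑ σ : Equiv.Perm (Fin n), (welfare A (upperTriangular σ) (fun _ => 1) : ℝ) =
      ∑ j : Fin n, ((n - j : ℕ) : ℝ) * assignCount A j j := by
  classical
  have hj : ∀ j : Fin n, ((n - j : ℕ) : ℝ) * assignCount A j j =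
      ∑ σ : Equiv.Perm (Fin n), ∑ k, if assign A (reports (upperTriangular σ) fun _ => 1) j =
        some k then (1 : ℝ) else 0 := by
    intro j
    rw [← Nat.cast_mul]
    have : (n - j : ℕ) * assignCount A j j = ∑ σ : Equiv.Perm (Fin n), ∑ k,
        if assign A (reports (upperTriangular σ) fun _ => 1) j = some k then 1 else 0 := by
      calc (n - j : ℕ) * assignCount A j j = ∑ k ∈ Finset.Ici j, assignCount A j k := by
            rw [Finset.sum_congr rfl fun k hk =>
              (assignCount_eq A le_rfl (Finset.mem_Ici.1 hk)).symm, Finset.sum_const,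
              Fin.card_Ici, smul_eq_mul]
        _ = ∑ k, assignCount A j k := by
            refine Finset.sum_subset (Finset.subset_univ _) fun k _ hk => ?_
            rw [assignCount, Finset.card_eq_zero, Finset.filter_eq_empty_iff]
            intro σ _ h
            have := mem_upperTriangular.1 ((hA n _ _).1 j _ h)
            rw [Equiv.symm_apply_apply] at this
            exact hk (Finset.mem_Ici.2 this)
        _ = _ := by
            rw [Finset.sum_congr rfl fun k _ => assignCount_eq_sum A j k, Finset.sum_comm]
            exact Finset.sum_congr rfl fun σ _ => Equiv.sum_comp σ fun k =>
              if assign A (reports (upperTriangular σ) fun _ => 1) j = some k then 1 else 0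
    rw [this]
    push_cast
    rfl
  rw [Finset.sum_congr rfl fun j _ => hj j, Finset.sum_comm]
  refine Finset.sum_congr rfl fun σ _ => ?_
  rw [hA.sum_items_eq, coe_welfare]
  simp

end UpperTriangular

/-! ### Bounding the linear program, and the randomized lower bound. -/

theorem log_sub_log_le_sum {D n : ℕ} (h : D ≤ n) :
    Real.log (n + 1) - Real.log (D + 1) ≤ ∑ e ∈ Finset.Ico D n, (1 : ℝ) / (e + 1) := by
  induction n, h using Nat.le_induction with
  | base => simp
  | succ n hn ih =>
    rw [Finset.sum_Ico_succ_top hn]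
    have hpos : (0 : ℝ) < n + 1 := by positivity
    -- One telescoping step: `log ((n + 2) / (n + 1)) ≤ 1 / (n + 1)`.
    have h1 := Real.log_le_sub_one_of_pos (x := ((n : ℝ) + 1 + 1) / (n + 1)) (by positivity)
    rw [Real.log_div (by positivity) (by positivity), add_div, div_self hpos.ne'] at h1
    push_cast
    linarith

theorem sum_welfare_upperTriangular_le {A : OnlineRule n} (hA : IsMatchingRule A) {D : ℕ}
    (hDn : D < n) (hD : 1 ≤ ∑ e ∈ Finset.Ico D n, (1 : ℝ) / (e + 1)) :
    ∑ σ : Equiv.Perm (Fin n), (welfare A (upperTriangular σ) (fun _ => 1) : ℝ) ≤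
      n.factorial * ((n : ℝ) - D) := by
  rw [sum_welfare_upperTriangular_eq hA]
  -- `D` is the multiplier of the constraint `sum_assignCount_le`. With `d = n - 1 - j`, the excess
  -- of `(d + 1) * a` over `D * a` is at most `n! * (1 - D / (d + 1))` if `D ≤ d`, by
  -- `sub_mul_assignCount_le`, and nonpositive otherwise.
  set g : ℕ → ℝ := fun e => if D ≤ e then 1 - (D : ℝ) * (1 / (e + 1)) else 0 with hg
  have hterm : ∀ j : Fin n, ((n - j : ℕ) : ℝ) * assignCount A j j ≤
      D * assignCount A j j + n.factorial * g (n - 1 - j) := by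
    intro j
    have hj := j.2
    obtain ⟨d, hd⟩ : ∃ d : ℕ, n - j = d + 1 := ⟨n - j - 1, by omega⟩
    have hd' : n - 1 - j = d := by omega
    have hle : ((d : ℝ) + 1) * assignCount A j j ≤ n.factorial := by
      have := sub_mul_assignCount_le A j
      rw [hd] at this
      exact_mod_cast this
    rw [hd, hd']
    push_cast
    simp only [hg]
    split_ifs with hDd
    · have hpos : (0 : ℝ) < d + 1 := by positivity
      have hDd' : (D : ℝ) ≤ d := by exact_mod_cast hDd
      have h1 : (0 : ℝ) ≤ 1 - D * (1 / (d + 1)) := by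
        rw [mul_one_div, sub_nonneg, div_le_one hpos]; linarith
      have h2 := mul_le_mul_of_nonneg_right hle h1
      have h3 : ((d : ℝ) + 1) * assignCount A j j * (1 - D * (1 / (d + 1))) =
          ((d : ℝ) + 1) * assignCount A j j - D * assignCount A j j := by field_simp
      linarith
    · have : (d : ℝ) + 1 ≤ D := by exact_mod_cast (by omega : d + 1 ≤ D)
      rw [mul_zero, add_zero]
      exact mul_le_mul_of_nonneg_right this (Nat.cast_nonneg _)
  have hcount : (∑ j, (assignCount A j j : ℝ)) ≤ n.factorial := by
    exact_mod_cast sum_assignCount_le hA (by omega)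
  -- The sum is `(n - D)` minus `D` times the harmonic sum, and the latter is at least `1` by `hD`.
  have hgsum : ∑ j : Fin n, g (n - 1 - j) ≤ (n : ℝ) - D - D := by
    rw [Fin.sum_univ_eq_sum_range fun j => g (n - 1 - j), Finset.sum_range_reflect]
    have hfilter : (Finset.range n).filter (fun e => D ≤ e) = Finset.Ico D n := by
      ext e; simp [and_comm]
    rw [hg, ← Finset.sum_filter, hfilter, Finset.sum_sub_distrib, ← Finset.mul_sum,
      Finset.sum_const, Nat.card_Ico, nsmul_eq_mul, mul_one, Nat.cast_sub hDn.le]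
    nlinarith [(Nat.cast_nonneg D : (0 : ℝ) ≤ D)]
  calc ∑ j : Fin n, ((n - j : ℕ) : ℝ) * assignCount A j j
      ≤ ∑ j : Fin n, (D * assignCount A j j + n.factorial * g (n - 1 - j)) :=
        Finset.sum_le_sum fun j _ => hterm j
    _ = D * ∑ j, (assignCount A j j : ℝ) + n.factorial * ∑ j : Fin n, g (n - 1 - j) := by
        rw [Finset.sum_add_distrib, Finset.mul_sum, Finset.mul_sum]
    _ ≤ D * n.factorial + n.factorial * ((n : ℝ) - D - D) := by gcongr
    _ = n.factorial * ((n : ℝ) - D) := by ring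

/-- Averaging over the orders of the buyers, some order is bad for the randomized rule. -/
theorem exists_expectedWelfare_upperTriangular_le {Ω : Type*} [MeasurableSpace Ω] (P : Measure Ω)
    [IsProbabilityMeasure P] {A : Ω → OnlineRule n} (hA : IsRandomizedMatchingRule A) {D : ℕ}
    (hDn : D < n) (hD : 1 ≤ ∑ e ∈ Finset.Ico D n, (1 : ℝ) / (e + 1)) :
    ∃ σ : Equiv.Perm (Fin n), expectedWelfare P A (upperTriangular σ) (fun _ => 1) ≤
      (n : ℝ) - D := by
  have hsum : ∑ σ : Equiv.Perm (Fin n), expectedWelfare P A (upperTriangular σ) (fun _ => 1) ≤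
      ∑ _ : Equiv.Perm (Fin n), ((n : ℝ) - D) := by
    unfold expectedWelfare
    rw [← integral_finsetSum _ fun σ _ => hA.integrable_welfare P _ _, Finset.sum_const,
      Finset.card_univ, Fintype.card_perm, Fintype.card_fin, nsmul_eq_mul]
    calc _ ≤ ∫ _, (n.factorial : ℝ) * ((n : ℝ) - D) ∂P :=
          integral_mono (integrable_finsetSum _ fun σ _ => hA.integrable_welfare P _ _)
            (integrable_const _) fun ω => sum_welfare_upperTriangular_le (hA.1 ω) hDn hD
      _ = _ := by simp
  obtain ⟨σ, -, hσ⟩ := Finset.exists_le_of_sum_le Finset.univ_nonempty hsum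
  exact ⟨σ, hσ⟩

theorem exists_harmonic_threshold {n : ℕ} (hn : 2 ≤ n) : ∃ D : ℕ, D < n ∧
    1 ≤ ∑ e ∈ Finset.Ico D n, (1 : ℝ) / (e + 1) ∧ (n : ℝ) - D ≤ n * (1 - (Real.exp 1)⁻¹) + 2 := by
  have he := Real.exp_pos 1
  have he3 : Real.exp 1 < 3 := Real.exp_one_lt_d9.trans (by norm_num)
  have he1 : 1 < Real.exp 1 := Real.one_lt_exp_iff.2 one_pos
  have hn' : (2 : ℝ) ≤ n := by exact_mod_cast hn
  -- `D` is `⌊(n + 1) / e⌋ - 1`: then `log ((n + 1) / (D + 1)) ≥ 1`, and rounding costs at most the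
  -- additive `2`. The floor is positive since `n + 1 ≥ 3 > e`.
  have hfl : 1 ≤ ⌊((n : ℝ) + 1) / Real.exp 1⌋₊ := by
    rw [Nat.one_le_floor_iff, le_div_iff₀ he]
    linarith
  obtain ⟨D, hD⟩ := Nat.exists_eq_add_of_le' hfl
  have hD1 : (D : ℝ) + 1 ≤ (n + 1) / Real.exp 1 := by
    have := Nat.floor_le (a := ((n : ℝ) + 1) / Real.exp 1) (by positivity)
    rw [hD] at this
    exact_mod_cast this
  have hD2 : ((n : ℝ) + 1) / Real.exp 1 < D + 1 + 1 := by
    have := Nat.lt_floor_add_one (((n : ℝ) + 1) / Real.exp 1)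
    rw [hD] at this
    exact_mod_cast this
  have hDn : D < n := by
    have : ((n : ℝ) + 1) / Real.exp 1 < n + 1 := div_lt_self (by positivity) he1
    have : (D : ℝ) < n := by linarith
    exact_mod_cast this
  refine ⟨D, hDn, ?_, ?_⟩
  · refine le_trans ?_ (log_sub_log_le_sum hDn.le)
    rw [le_div_iff₀ he] at hD1
    have := Real.log_le_log (by positivity) hD1
    rw [Real.log_mul (by positivity) he.ne', Real.log_exp] at this
    linarith
  · have : (n : ℝ) * (Real.exp 1)⁻¹ ≤ (n + 1) / Real.exp 1 := by
      rw [div_eq_mul_inv]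
      have := inv_pos.2 he
      nlinarith
    linarith

theorem randomized_lower_bound {α : ℝ} (hα : α < Real.exp 1 / (Real.exp 1 - 1)) :
    ∃ n : ℕ, ∀ (Ω : Type*) [MeasurableSpace Ω] (P : Measure Ω) [IsProbabilityMeasure P]
      (A : Ω → OnlineRule n), IsRandomizedMatchingRule A →
        ∃ E : BuyerItemGraph n n,
          α * expectedWelfare P A E (fun _ => 1) < opt E (fun _ => 1) := by
  have he1 : 1 < Real.exp 1 := Real.one_lt_exp_iff.2 one_pos
  set γ := 1 - (Real.exp 1)⁻¹ with hγ
  have hγ0 : 0 < γ := sub_pos.2 (inv_lt_one_of_one_lt₀ he1)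
  have hγe : Real.exp 1 / (Real.exp 1 - 1) * γ = 1 := by
    rw [hγ]; have : Real.exp 1 - 1 ≠ 0 := by linarith
    field_simp
  -- Passing to a nonnegative ratio keeps multiplication by it monotone.
  set β := max α 0 with hβ
  have hβ0 : 0 ≤ β := le_max_right _ _
  have hβγ : 0 < 1 - β * γ := by
    rw [sub_pos, ← hγe]
    exact mul_lt_mul_of_pos_right (max_lt hα (div_pos (by linarith) (by linarith))) hγ0
  -- Chosen so that the rounding term is absorbed: `β * (n * γ + 2) < n` for `n = N + 2`.
  obtain ⟨N, hN⟩ := exists_nat_gt (2 * β / (1 - β * γ))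
  obtain ⟨D, hDn, hD, hbound⟩ := exists_harmonic_threshold (Nat.le_add_left 2 N)
  refine ⟨N + 2, fun Ω _ P _ A hA => ?_⟩
  obtain ⟨σ, hσ⟩ := exists_expectedWelfare_upperTriangular_le P hA hDn hD
  refine ⟨upperTriangular σ, ?_⟩
  have hopt : ((N + 2 : ℕ) : ℝ) ≤ opt (upperTriangular σ) (fun _ => 1) := by
    exact_mod_cast natCast_le_opt_upperTriangular σ
  have hw0 : 0 ≤ expectedWelfare P A (upperTriangular σ) (fun _ => 1) :=
    integral_nonneg fun ω => NNReal.coe_nonneg _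
  rw [div_lt_iff₀ hβγ] at hN
  calc α * expectedWelfare P A (upperTriangular σ) (fun _ => 1)
      ≤ β * expectedWelfare P A (upperTriangular σ) (fun _ => 1) :=
        mul_le_mul_of_nonneg_right (le_max_left _ _) hw0
    _ ≤ β * (((N + 2 : ℕ) : ℝ) * γ + 2) :=
        mul_le_mul_of_nonneg_left (hσ.trans hbound) hβ0
    _ < ((N + 2 : ℕ) : ℝ) := by push_cast; nlinarith
    _ ≤ _ := hopt

end OnlineMatching

theorem mainTheorem2 :
    -- Greedy with critical prices: a deterministic truthful tardy mechanism with ratio 2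
    (∀ n : ℕ,
      OnlineMatching.IsMatchingRule (OnlineMatching.greedy n) ∧
      (OnlineMatching.criticalPriceMechanism (OnlineMatching.greedy n)).IsTruthful ∧
      (OnlineMatching.criticalPriceMechanism (OnlineMatching.greedy n)).IsIndividuallyRational ∧
      OnlineMatching.IsCompetitive 2 (OnlineMatching.greedy n)) ∧
    -- Perturbed-Greedy, i.i.d. uniform perturbations, critical prices for the realized perturbations
    (∀ n : ℕ,
      OnlineMatching.IsRandomizedMatchingRule (OnlineMatching.perturbedGreedy n) ∧
      (∀ x : Fin n → unitInterval,
        (OnlineMatching.criticalPriceMechanism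
          (OnlineMatching.perturbedGreedy n x)).IsTruthful ∧
        (OnlineMatching.criticalPriceMechanism
          (OnlineMatching.perturbedGreedy n x)).IsIndividuallyRational) ∧
      OnlineMatching.IsCompetitiveInExpectation (Real.exp 1 / (Real.exp 1 - 1))
        (volume : Measure (Fin n → unitInterval)) (OnlineMatching.perturbedGreedy n)) ∧
    -- no deterministic online algorithm has a ratio below 2
    (∀ α : ℝ, α < 2 → ∃ (n m : ℕ) (v : Fin n → ℝ≥0),
      ∀ A : OnlineMatching.OnlineRule n, OnlineMatching.IsMatchingRule A →
        ∃ E : OnlineMatching.BuyerItemGraph n m,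
          α * OnlineMatching.welfare A E v < OnlineMatching.opt E v) ∧
    -- no randomized online algorithm has a ratio below e / (e - 1)
    (∀ α : ℝ, α < Real.exp 1 / (Real.exp 1 - 1) → ∃ (n m : ℕ) (v : Fin n → ℝ≥0),
      ∀ (Ω : Type*) [MeasurableSpace Ω] (P : Measure Ω) [IsProbabilityMeasure P]
        (A : Ω → OnlineMatching.OnlineRule n), OnlineMatching.IsRandomizedMatchingRule A →
        ∃ E : OnlineMatching.BuyerItemGraph n m,
          α * OnlineMatching.expectedWelfare P A E v < OnlineMatching.opt E v) := by
  refine ⟨fun n => ?_, fun n => ⟨?_, fun x => ?_, ?_⟩, fun α hα => ?_, fun α hα => ?_⟩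
  · have hA := OnlineMatching.isMatchingRule_weightedGreedy (fun _ : Fin n => (1 : ℝ))
    exact ⟨hA, OnlineMatching.isTruthful_criticalPriceMechanism hA fun _ _ _ _ hz =>
      OnlineMatching.wins_rebid_mono (fun _ => zero_le_one) hz,
      OnlineMatching.isIndividuallyRational_criticalPriceMechanism hA,
      OnlineMatching.isCompetitive_greedy n⟩
  · exact OnlineMatching.isRandomizedMatchingRule_perturbedGreedy n
  · have hA := OnlineMatching.isMatchingRule_weightedGreedy (OnlineMatching.multiplier x)
    exact ⟨OnlineMatching.isTruthful_criticalPriceMechanism hA fun _ _ _ _ hz =>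
      OnlineMatching.wins_rebid_mono (OnlineMatching.multiplier_nonneg x) hz,
      OnlineMatching.isIndividuallyRational_criticalPriceMechanism hA⟩
  · exact OnlineMatching.isCompetitiveInExpectation_perturbedGreedy n
  · exact ⟨2, 2, fun _ => 1, fun A _ => OnlineMatching.deterministic_lower_bound hα A⟩
  · obtain ⟨n, hn⟩ := OnlineMatching.randomized_lower_bound hα
    exact ⟨n, n, fun _ => 1, hn⟩
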